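/- Let $a:[0,1]\times[0,2\pi]\to\mathbb C$ be such that $x\mapsto a(x,t)$ is Riemann integrable on $[0,1]$ for every $t\in[0,2\pi]$ and $t\mapsto a(x,t)$ belongs to $L^\infty([0,2\pi])$ for every $x\in[0,1]$. Put $$\hat a_k(x)=\frac1{2\pi}\int_0^{2\pi}a(x,t)e^{-ikt}\,dt\qquad(k\in\mathbb Z),$$ assume that $\sum_{k\in\mathbb Z}\|\hat a_k\|_\infty<\infty$, where $\|f\|_\infty=\sup_{x\in[0,1]}|f(x)|$, and let $$T_n(a)=\left[\hat a_{j-i}\!\left(\frac{i+j}{2n+2}\right)\right]_{i,j=0}^{n}$$ be the associated Kac--Murdock--Szegő matrices. Let $$\mathcal R(a)=\bigl\{z\in\mathbb C:\ \operatorname{meas}\{(x,t)\in[0,1]\times[0,2\pi]:|a(x,t)-z|<r\}>0\ \text{ for all } r>0\bigr\}$$ be the essential range of $a$ ($\operatorname{meas}$ is Lebesgue measure), and let the extended range $\mathcal{ER}(a)$ be the union of $\mathcal R(a)$ and all bounded connected components of $\mathbb C\setminus\mathcal R(a)$. Then $\mathcal{ER}(a)$ is a cluster of the eigenvalues of $T_n(a)$: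 for every open set $V\subseteq\mathbb C$ with $\mathcal{ER}(a)\subseteq V$, $$\lim_{n\to\infty}\frac{\mathcal N(V,n)}{n+1}=1,$$ where $\mathcal N(V,n)$ is the number of eigenvalues of $T_n(a)$ in $V$, counted with algebraic multiplicity. In other words, all but $o(n)$ of the $n+1$ eigenvalues of $T_n(a)$ lie in $V$. -/

import Mathlib

open MeasureTheory Set Filter Topology Asymptotics

noncomputable section

namespace KMS

/-- The one-dimensional box `(0, 1]` (its closure is `[0, 1]`), as a box in `Fin 1 → ℝ`. -/
def unitBox : BoxIntegral.Box (Fin 1) where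
  lower := fun _ => 0
  upper := fun _ => 1
  lower_lt_upper := fun _ => zero_lt_one

/-- `f` is Riemann integrable on `[0, 1]`: the Riemann sums over tagged partitions of `[0, 1]`
converge as the mesh tends to `0`. -/
def RiemannIntegrable (f : ℝ → ℂ) : Prop :=
  BoxIntegral.Integrable unitBox BoxIntegral.IntegrationParams.Riemann
    (fun v : Fin 1 → ℝ => f (v 0)) BoxIntegral.BoxAdditiveMap.volume

/-- The `k`-th Fourier coefficient `â_k(x) = (1/2π) ∫₀^{2π} a(x,t) e^{-ikt} dt`. -/
def coeff (a : ℝ → ℝ → ℂ) (k : ℤ) (x : ℝ) : ℂ :=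
  (1 / (2 * Real.pi : ℂ)) *
    ∫ t in (0 : ℝ)..(2 * Real.pi), a x t * Complex.exp (-(Complex.I * k * t))

/-- `∑_{k ∈ ℤ} ‖â_k‖_∞`, where `‖f‖_∞ = sup_{x ∈ [0,1]} |f x|`, as an element of `[0, ∞]`. -/
def decayNorm (a : ℝ → ℝ → ℂ) : ENNReal :=
  ∑' k : ℤ, ⨆ x ∈ Icc (0 : ℝ) 1, ‖coeff a k x‖ₑ

/-- The `(n+1) × (n+1)` matrix `T_n(a) = [â_{j-i}((i+j)/(2n+2))]_{i,j=0}^n`. -/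
def matrix (a : ℝ → ℝ → ℂ) (n : ℕ) : Matrix (Fin (n + 1)) (Fin (n + 1)) ℂ :=
  Matrix.of fun i j =>
    coeff a (((j : ℕ) : ℤ) - ((i : ℕ) : ℤ)) ((((i : ℕ) : ℝ) + ((j : ℕ) : ℝ)) / (2 * (n : ℝ) + 2))

/-- The essential range of `a` on `[0,1] × [0,2π]`. -/
def essRange (a : ℝ → ℝ → ℂ) : Set ℂ :=
  {z | ∀ r : ℝ, 0 < r →
    0 < volume {p : ℝ × ℝ | p ∈ Icc (0 : ℝ) 1 ×ˢ Icc (0 : ℝ) (2 * Real.pi) ∧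
      a p.1 p.2 ∈ Metric.ball z r}}

/-- The extended range: the essential range together with all bounded connected components
of its complement. -/
def extRange (a : ℝ → ℝ → ℂ) : Set ℂ :=
  essRange a ∪
    {z | z ∈ (essRange a)ᶜ ∧ Bornology.IsBounded (connectedComponentIn (essRange a)ᶜ z)}

open Classical in
/-- The number of eigenvalues of `T_n(a)` in `V`, counted with algebraic multiplicity. -/
def eigCount (a : ℝ → ℝ → ℂ) (V : Set ℂ) (n : ℕ) : ℕ :=
  (matrix a n).charpoly.roots.countP (fun z => z ∈ V)

end KMS

end

/-! Let z₀ lie outside the extended range. For a.e. x and all t, the Fourier series ∑ â_k(x) e^{ikt}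
takes its values in a compact set K = `seriesRange a` inside the essential range, and z₀ lies in an
unbounded component of Kᶜ. Hence some polynomial p has p(z₀) = 1 and |p| ≤ 1/4 on K
(`exists_polynomial_small_on`). By Schur's inequality (`sum_norm_sq_eval_roots_le`), the sum of
|p(λ)|^{2m} over the eigenvalues is at most the squared Frobenius norm of p^m(T_n(a)). If that is at
most about 16^{-m} n, then, since |p| ≥ 1/2 near z₀, only about a 4^{-m} fraction of the eigenvalues
is near z₀, and m is arbitrary. All eigenvalues lie in a fixed disc, so compactness concludes.

The Frobenius bound (`eventually_sum_norm_sq_aeval_le`) is local. Around row ⌊x(n+1)⌋ the matrix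
resembles the Laurent matrix with symbol a(x,·), so the squared norm of that row of q(T_n(a)) tends
to the sum of the squared Fourier moduli of q∘a(x,·), which Bessel bounds by the squared supremum.
Averaging over rows becomes integration over x by dominated convergence. This requires â_k to be
continuous at a.e. x (`ae_continuousAt_coeff`), which comes from Riemann integrability in x: for
each t the mean oscillation on fine grids vanishes, and integrating over t passes this to â_k. -/

namespace KMS

/-! ### Schur triangulation and Schur's inequality. -/

/-- **Schur triangulation**: every endomorphism of a finite-dimensional complex inner product
space is upper triangular in some orthonormal basis. -/
theorem exists_orthonormalBasis_triangular (n : ℕ) :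
    ∀ {E : Type} [NormedAddCommGroup E] [InnerProductSpace ℂ E] [FiniteDimensional ℂ E]
      (_ : Module.finrank ℂ E = n) (T : E →ₗ[ℂ] E),
      ∃ b : OrthonormalBasis (Fin n) ℂ E, ∀ i j, j < i → inner ℂ (b i) (T (b j)) = 0 := by
  induction n with
  | zero =>
    intro E _ _ _ hE T
    exact ⟨(stdOrthonormalBasis ℂ E).reindex (finCongr hE), fun i => i.elim0⟩
  | succ n ih =>
    intro E _ _ _ hE T
    have : Nontrivial E := Module.nontrivial_of_finrank_pos (R := ℂ) (by omega)
    obtain ⟨μ, hμ⟩ := Module.End.exists_eigenvalue T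
    obtain ⟨w, hw⟩ := hμ.exists_hasEigenvector
    have hw0 : w ≠ 0 := hw.2
    set v : E := ((‖w‖⁻¹ : ℝ) : ℂ) • w with hv
    have hvn : ‖v‖ = 1 := by
      have : ‖w‖ ≠ 0 := norm_ne_zero_iff.2 hw0
      simp [hv, norm_smul, this]
    have hTv : T v = μ • v := by
      rw [hv, map_smul, hw.apply_eq_smul, smul_comm]
    have hv0 : v ≠ 0 := by
      intro h; simp [h] at hvn
    set W : Submodule ℂ E := (ℂ ∙ v)ᗮ with hW
    have hWn : Module.finrank ℂ W = n := by
      have := Fact.mk hE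
      exact Submodule.finrank_orthogonal_span_singleton (n := n) hv0
    -- The complement W need not be `T`-invariant, so the induction uses the compression of `T` to
    -- W; this leaves the entries ⟨b i, T (b j)⟩ unchanged because b i ∈ W.
    obtain ⟨b, hb⟩ := ih hWn
      ((W.orthogonalProjectionOnto : E →ₗ[ℂ] W) ∘ₗ T ∘ₗ W.subtype)
    have hvb : ∀ i, inner ℂ v (b i : E) = 0 := fun i =>
      (Submodule.mem_orthogonal_singleton_iff_inner_right).1 (b i).2
    have hbv : ∀ i, inner ℂ (b i : E) v = 0 := fun i =>
      (Submodule.mem_orthogonal_singleton_iff_inner_left).1 (b i).2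
    have hbb : ∀ i j, inner ℂ (b i : E) (b j : E) = if i = j then (1 : ℂ) else 0 := by
      intro i j
      have := orthonormal_iff_ite.1 b.orthonormal i j
      simpa using this
    have hon : Orthonormal ℂ (Fin.cons v (fun i => (b i : E)) : Fin (n + 1) → E) := by
      rw [orthonormal_iff_ite]
      intro i j
      refine Fin.cases ?_ (fun i => ?_) i <;> refine Fin.cases ?_ (fun j => ?_) j
      · simp [inner_self_eq_norm_sq_to_K, hvn]
      · simp [hvb, (Fin.succ_ne_zero j).symm]
      · simp [hbv]
      · simp [hbb]
    have hcard : Fintype.card (Fin (n + 1)) = Module.finrank ℂ E := by simp [hE]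
    refine ⟨OrthonormalBasis.mk hon
      (hon.linearIndependent.span_eq_top_of_card_eq_finrank' hcard).ge, ?_⟩
    intro i j hij
    rw [OrthonormalBasis.coe_mk]
    revert hij
    refine Fin.cases ?_ (fun i => ?_) i <;> refine Fin.cases ?_ (fun j => ?_) j <;> intro hij
    · exact absurd hij (lt_irrefl _)
    · exact absurd hij (Fin.not_lt_zero _)
    · simp [hTv, hbv]
    · have := hb i j (Fin.succ_lt_succ_iff.1 hij)
      simpa using this

/-- The Hilbert–Schmidt norms of an endomorphism and its adjoint agree, whatever the orthonormal
bases used to compute them. -/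
theorem sum_norm_sq_apply_eq {ι κ E : Type*} [Fintype ι] [Fintype κ] [NormedAddCommGroup E]
    [InnerProductSpace ℂ E] [FiniteDimensional ℂ E]
    (b : OrthonormalBasis ι ℂ E) (c : OrthonormalBasis κ ℂ E) (S : E →ₗ[ℂ] E) :
    ∑ j, ‖S (b j)‖ ^ 2 = ∑ j, ‖S.adjoint (c j)‖ ^ 2 := by
  have h1 : ∀ j, ‖S (b j)‖ ^ 2 = ∑ i, ‖inner ℂ (c i) (S (b j))‖ ^ 2 := fun j =>
    (c.sum_sq_norm_inner_right _).symm
  have h2 : ∀ i, ‖S.adjoint (c i)‖ ^ 2 = ∑ j, ‖inner ℂ (S.adjoint (c i)) (b j)‖ ^ 2 := fun i =>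
    (b.sum_sq_norm_inner_left _).symm
  simp_rw [h1, h2, LinearMap.adjoint_inner_left]
  exact Finset.sum_comm

/-- The diagonal of a product of upper triangular matrices. -/
theorem mul_apply_diag_of_isUpperTriangular {n : ℕ} {A B : Matrix (Fin n) (Fin n) ℂ}
    (hA : A.IsUpperTriangular) (hB : B.IsUpperTriangular) (i : Fin n) :
    (A * B) i i = A i i * B i i := by
  rw [Matrix.mul_apply, Finset.sum_eq_single i]
  · intro j _ hj
    rcases lt_or_gt_of_ne hj with h | h
    · rw [hA h, zero_mul]
    · rw [hB h, mul_zero]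
  · simp

theorem aeval_isUpperTriangular {n : ℕ} {A : Matrix (Fin n) (Fin n) ℂ}
    (hA : A.IsUpperTriangular) (p : Polynomial ℂ) :
    (Polynomial.aeval A p).IsUpperTriangular ∧
      ∀ i, Polynomial.aeval A p i i = p.eval (A i i) := by
  induction p using Polynomial.induction_on with
  | C c =>
    simp only [Polynomial.aeval_C, Polynomial.eval_C]
    refine ⟨Matrix.blockTriangular_algebraMap c, fun i => by simp [Matrix.algebraMap_matrix_apply]⟩
  | add p q hp hq =>
    simp only [map_add, Polynomial.eval_add]
    exact ⟨Matrix.BlockTriangular.add hp.1 hq.1, fun i => by rw [Matrix.add_apply, hp.2, hq.2]⟩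
  | monomial k c h =>
    rw [pow_succ, ← mul_assoc, map_mul, Polynomial.aeval_X]
    refine ⟨Matrix.BlockTriangular.mul h.1 hA, fun i => ?_⟩
    rw [mul_apply_diag_of_isUpperTriangular h.1 hA, h.2, Polynomial.eval_mul_X]

/-- **Schur's inequality** for polynomials in a matrix. -/
theorem sum_norm_sq_eval_roots_le {n : ℕ} (M : Matrix (Fin n) (Fin n) ℂ) (p : Polynomial ℂ) :
    (M.charpoly.roots.map fun z => ‖p.eval z‖ ^ 2).sum ≤
      ∑ i, ∑ j, ‖Polynomial.aeval M p i j‖ ^ 2 := by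
  set e : OrthonormalBasis (Fin n) ℂ (EuclideanSpace ℂ (Fin n)) := EuclideanSpace.basisFun _ _
  set T : Module.End ℂ (EuclideanSpace ℂ (Fin n)) := Matrix.toLin e.toBasis e.toBasis M
  obtain ⟨b, hb⟩ := exists_orthonormalBasis_triangular n (by simp) T
  set R := LinearMap.toMatrix b.toBasis b.toBasis T with hR
  have hentry : ∀ (c : OrthonormalBasis (Fin n) ℂ (EuclideanSpace ℂ (Fin n)))
      (S : Module.End ℂ (EuclideanSpace ℂ (Fin n))) (i j : Fin n),
      LinearMap.toMatrix c.toBasis c.toBasis S i j = inner ℂ (c i) (S (c j)) := by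
    intro c S i j
    simp [LinearMap.toMatrix_apply, OrthonormalBasis.repr_apply_apply]
  have hfrob : ∀ (c : OrthonormalBasis (Fin n) ℂ (EuclideanSpace ℂ (Fin n)))
      (S : Module.End ℂ (EuclideanSpace ℂ (Fin n))),
      ∑ i, ∑ j, ‖LinearMap.toMatrix c.toBasis c.toBasis S i j‖ ^ 2 = ∑ j, ‖S (c j)‖ ^ 2 := by
    intro c S
    rw [Finset.sum_comm]
    simp_rw [hentry, c.sum_sq_norm_inner_right]
  have hRt : R.IsUpperTriangular := fun i j hij => by rw [hR, hentry]; exact hb i j hij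
  have hchar : M.charpoly = R.charpoly := by
    rw [hR, LinearMap.charpoly_toMatrix, ← LinearMap.charpoly_toMatrix T e.toBasis,
      LinearMap.toMatrix_toLin]
  have haeval : ∀ c : OrthonormalBasis (Fin n) ℂ (EuclideanSpace ℂ (Fin n)),
      LinearMap.toMatrix c.toBasis c.toBasis (Polynomial.aeval T p) =
        Polynomial.aeval (LinearMap.toMatrix c.toBasis c.toBasis T) p := fun c =>
    (Polynomial.aeval_algHom_apply (LinearMap.toMatrixAlgEquiv c.toBasis) T p).symm
  have hroots : M.charpoly.roots = Finset.univ.val.map fun i => R i i := by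
    rw [hchar, Matrix.charpoly_of_isUpperTriangular R hRt,
      Polynomial.roots_prod _ _ (Finset.prod_ne_zero_iff.2 fun i _ => Polynomial.X_sub_C_ne_zero _)]
    simp [Multiset.bind_singleton]
  have hM : LinearMap.toMatrix e.toBasis e.toBasis T = M := LinearMap.toMatrix_toLin _ _ M
  calc (M.charpoly.roots.map fun z => ‖p.eval z‖ ^ 2).sum
      = ∑ i, ‖Polynomial.aeval R p i i‖ ^ 2 := by
        rw [hroots, Multiset.map_map]
        simp only [Function.comp_def, (aeval_isUpperTriangular hRt p).2]
        rfl
    _ ≤ ∑ i, ∑ j, ‖Polynomial.aeval R p i j‖ ^ 2 :=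
        Finset.sum_le_sum fun i _ => Finset.single_le_sum
          (f := fun j => ‖Polynomial.aeval R p i j‖ ^ 2) (fun j _ => by positivity)
          (Finset.mem_univ i)
    _ = ∑ i, ∑ j, ‖Polynomial.aeval M p i j‖ ^ 2 := by
        -- The Frobenius norm does not depend on the orthonormal basis: pass from `b` to the adjoint
        -- in `e`, then back to the operator in `e`.
        rw [hR, ← haeval, hfrob, sum_norm_sq_apply_eq b e, ← sum_norm_sq_apply_eq e e, ← hfrob,
          haeval, hM]

end KMS

/-! ### Polynomial separation of a point from a compact set. -/

namespace KMS

/-- A point in an unbounded component of the complement of a compact set `K` can be separated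
from `K` by polynomials. -/
theorem exists_polynomial_small_on {K : Set ℂ} (hK : IsCompact K) {z₀ : ℂ}
    (hunb : ¬ Bornology.IsBounded (connectedComponentIn Kᶜ z₀)) {ε : ℝ} (hε : 0 < ε) :
    ∃ p : Polynomial ℂ, p.eval z₀ = 1 ∧ ∀ z ∈ K, ‖p.eval z‖ ≤ ε := by
  have : CompactSpace K := isCompact_iff_compactSpace.1 hK
  -- In C(K) the coordinate function has spectrum K. Passing to the closed subalgebra generated by
  -- polynomials can only fill in bounded components of Kᶜ, so z₀ − X stays invertible there. A
  -- polynomial q close to the inverse makes 1 − (z₀ − X) q small on K, with value 1 at z₀.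
  set S : Subalgebra ℂ C(K, ℂ) := (polynomialFunctions K).topologicalClosure with hS
  have hSc : IsClosed (S : Set C(K, ℂ)) := Subalgebra.isClosed_topologicalClosure _
  set f : C(K, ℂ) := Polynomial.toContinuousMapOn Polynomial.X K with hf
  have hfS : f ∈ S := Subalgebra.le_topologicalClosure _ ⟨Polynomial.X, by simp [hf]⟩
  set x : S := ⟨f, hfS⟩
  have hspec : spectrum ℂ (x : C(K, ℂ)) = K := by
    rw [ContinuousMap.spectrum_eq_range]
    ext z
    simp [x, hf]
  have hz : z₀ ∉ spectrum ℂ x := fun h => hunb (by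
    have := Subalgebra.spectrum_isBounded_connectedComponentIn S x h
    rwa [hspec] at this)
  rw [spectrum.notMem_iff] at hz
  obtain ⟨u, hu⟩ := hz.exists_right_inv
  set g : C(K, ℂ) := algebraMap ℂ C(K, ℂ) z₀ - f with hg
  have hgu : g * (u : C(K, ℂ)) = 1 := by
    have := congrArg (Subtype.val) hu
    simpa using this
  obtain ⟨q', ⟨q, -, rfl⟩, hq⟩ := Metric.mem_closure_iff.1
    (show (u : C(K, ℂ)) ∈ closure (polynomialFunctions K : Set C(K, ℂ)) from u.2)
    (ε / (‖g‖ + 1)) (by positivity)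
  refine ⟨1 - (Polynomial.C z₀ - Polynomial.X) * q, by simp, fun z hz => ?_⟩
  have h1 : (1 : ℂ) = (z₀ - z) * (u : C(K, ℂ)) ⟨z, hz⟩ := by
    have := congrArg (fun h : C(K, ℂ) => h ⟨z, hz⟩) hgu
    simpa [hg, hf] using this.symm
  have h2 : ‖(u : C(K, ℂ)) ⟨z, hz⟩ - q.eval z‖ ≤ ε / (‖g‖ + 1) := by
    refine le_trans ?_ hq.le
    rw [dist_eq_norm]
    simpa using ((u : C(K, ℂ)) - Polynomial.toContinuousMapOn q K).norm_coe_le_norm ⟨z, hz⟩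
  have h3 : ‖z₀ - z‖ ≤ ‖g‖ := by
    simpa [hg, hf] using g.norm_coe_le_norm ⟨z, hz⟩
  have h4 : (1 - (Polynomial.C z₀ - Polynomial.X) * q).eval z =
      (z₀ - z) * ((u : C(K, ℂ)) ⟨z, hz⟩ - q.eval z) := by
    rw [mul_sub, ← h1]; simp
  rw [h4, norm_mul]
  calc ‖z₀ - z‖ * ‖(u : C(K, ℂ)) ⟨z, hz⟩ - q.eval z‖ ≤ (‖g‖ + 1) * (ε / (‖g‖ + 1)) := by
        gcongr; linarith
    _ = ε := by field_simp

end KMS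

/-! ### Riemann sums and mean oscillation over equidistant grids. -/

namespace KMS

/-- `x` picks a point in each of the `m` closed intervals of length `1 / m` in `[0, 1]`. -/
def IsGridTag (m : ℕ) (x : ℕ → ℝ) : Prop :=
  ∀ i < m, x i ∈ Icc ((i : ℝ) / m) (((i : ℝ) + 1) / m)

theorem IsGridTag.mem_Icc {m : ℕ} {x : ℕ → ℝ} (hx : IsGridTag m x) {i : ℕ} (hi : i < m) :
    x i ∈ Icc (0 : ℝ) 1 := by
  have hm : (0 : ℝ) < m := by exact_mod_cast (by omega : 0 < m)
  obtain ⟨h1, h2⟩ := hx i hi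
  refine ⟨le_trans (by positivity) h1, h2.trans ?_⟩
  rw [div_le_one hm]
  exact_mod_cast hi

/-- The partition of `[0, 1]` into `m` intervals of equal length, with tags `x`. -/
noncomputable def gridPartition (m : ℕ) [NeZero m] (x : ℕ → ℝ) :
    BoxIntegral.TaggedPrepartition unitBox where
  toPrepartition := (BoxIntegral.unitPartition.prepartition m unitBox).toPrepartition
  -- The floor recovers the index i from the lower corner i / m. Clamping to [0, 1] makes this a
  -- legal tag for every box and every `x`; on genuine grid tags it changes nothing.
  tag J := fun _ => max 0 (min 1 (x ⌊(m : ℝ) * J.lower 0⌋₊))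
  tag_mem_Icc J := by
    rw [BoxIntegral.Box.Icc_def]
    simp [unitBox, Pi.le_def]

theorem mem_admissibleIndex_unitBox {m : ℕ} [NeZero m] {ν : Fin 1 → ℤ} :
    ν ∈ BoxIntegral.unitPartition.admissibleIndex m unitBox ↔ 0 ≤ ν 0 ∧ ν 0 < m := by
  have hm : (0 : ℝ) < m := by exact_mod_cast (NeZero.pos m)
  rw [BoxIntegral.unitPartition.mem_admissibleIndex_iff, BoxIntegral.Box.le_iff_bounds]
  simp only [Pi.le_def, unitBox, BoxIntegral.unitPartition.box_lower,
    BoxIntegral.unitPartition.box_upper, Fin.forall_fin_one]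
  rw [le_div_iff₀ hm, zero_mul, div_le_one hm]
  constructor
  · rintro ⟨h1, h2⟩
    exact ⟨by exact_mod_cast h1, by exact_mod_cast h2⟩
  · rintro ⟨h1, h2⟩
    exact ⟨by exact_mod_cast h1, by exact_mod_cast h2⟩

/-- The box `(i / m, (i + 1) / m]`. -/
noncomputable def gridBox (m : ℕ) [NeZero m] : ℕ ↪ BoxIntegral.Box (Fin 1) where
  toFun i := BoxIntegral.unitPartition.box m fun _ => (i : ℤ)
  inj' i j h := by
    have h' := BoxIntegral.unitPartition.box_injective m h
    simpa using congrFun h' 0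

theorem gridBox_apply (m : ℕ) [NeZero m] (i : ℕ) :
    gridBox m i = BoxIntegral.unitPartition.box m fun _ => (i : ℤ) := rfl

theorem gridPartition_tag_box {m : ℕ} [NeZero m] {x : ℕ → ℝ} (hx : IsGridTag m x) {i : ℕ}
    (hi : i < m) :
    (gridPartition m x).tag (gridBox m i) = fun _ => x i := by
  have hm : (m : ℝ) ≠ 0 := by exact_mod_cast NeZero.ne m
  have h := hx.mem_Icc hi
  funext j
  have : (m : ℝ) * (i / m) = i := by field_simp
  simp [gridPartition, gridBox_apply, BoxIntegral.unitPartition.box_lower, this, h.1, h.2]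

theorem gridPartition_boxes {m : ℕ} [NeZero m] (x : ℕ → ℝ) :
    (gridPartition m x).boxes = (Finset.range m).map (gridBox m) := by
  ext J
  change J ∈ BoxIntegral.unitPartition.prepartition m unitBox ↔ _
  rw [BoxIntegral.unitPartition.mem_prepartition_iff]
  simp only [mem_admissibleIndex_unitBox, Finset.mem_map, Finset.mem_range, gridBox_apply]
  constructor
  · rintro ⟨ν, ⟨h0, h1⟩, rfl⟩
    refine ⟨(ν 0).toNat, by omega, ?_⟩
    congr 1
    funext j
    rw [Subsingleton.elim j 0]
    omega
  · rintro ⟨i, hi, rfl⟩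
    exact ⟨_, ⟨by simp, by simpa using hi⟩, rfl⟩

theorem integralSum_gridPartition {m : ℕ} [NeZero m] {x : ℕ → ℝ} (hx : IsGridTag m x)
    (f : ℝ → ℂ) :
    BoxIntegral.integralSum (fun v : Fin 1 → ℝ => f (v 0)) BoxIntegral.BoxAdditiveMap.volume
      (gridPartition m x) = (m : ℂ)⁻¹ * ∑ i ∈ Finset.range m, f (x i) := by
  rw [BoxIntegral.integralSum, gridPartition_boxes, Finset.sum_map, Finset.mul_sum]
  refine Finset.sum_congr rfl fun i hi => ?_
  rw [Finset.mem_range] at hi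
  rw [gridPartition_tag_box hx hi, BoxIntegral.BoxAdditiveMap.volume_apply]
  simp [gridBox_apply, BoxIntegral.unitPartition.box_lower,
    BoxIntegral.unitPartition.box_upper, add_div]

/-- Riemann sums of a Riemann integrable function over fine equidistant partitions hardly depend
on the tags. -/
theorem RiemannIntegrable.eventually_norm_sum_sub_le {f : ℝ → ℂ} (hf : RiemannIntegrable f)
    {ε : ℝ} (hε : 0 < ε) :
    ∀ᶠ m : ℕ in atTop, ∀ x y : ℕ → ℝ, IsGridTag m x → IsGridTag m y →
      ‖∑ i ∈ Finset.range m, (f (x i) - f (y i))‖ ≤ m * ε := by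
  set r := BoxIntegral.Integrable.convergenceR hf (ε / 2) 0 with hr
  -- For `Riemann` the gauge is constant, so `r 0` is a plain bound on the mesh. No distortion
  -- condition is imposed, hence the distortion constant 0.
  have hr0 : ∀ v, r v = r 0 := BoxIntegral.Integrable.convergenceR_cond hf (ε / 2) 0 rfl
  have hpos : (0 : ℝ) < r 0 := (r 0).2
  filter_upwards [eventually_ge_atTop 1,
    tendsto_one_div_atTop_nhds_zero_nat.eventually (ge_mem_nhds hpos)] with m hm1 hm x y hx hy
  have : NeZero m := ⟨by omega⟩
  have hmem : ∀ z : ℕ → ℝ, IsGridTag m z →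
      BoxIntegral.IntegrationParams.Riemann.MemBaseSet unitBox 0 r (gridPartition m z) := by
    intro z hz
    have hH : (gridPartition m z).IsHenstock := by
      intro J hJ
      change J ∈ (gridPartition m z).boxes at hJ
      rw [gridPartition_boxes, Finset.mem_map] at hJ
      obtain ⟨i, hi, rfl⟩ := hJ
      rw [Finset.mem_range] at hi
      rw [gridPartition_tag_box hz hi, BoxIntegral.Box.Icc_def]
      obtain ⟨h1, h2⟩ := hz i hi
      simp [gridBox_apply, Pi.le_def, h1, h2]
    refine ⟨fun J hJ => ?_, fun _ => hH, fun h => absurd h (by decide),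
      fun h => absurd h (by decide)⟩
    have hJH := hH J hJ
    change J ∈ (gridPartition m z).boxes at hJ
    rw [gridPartition_boxes, Finset.mem_map] at hJ
    obtain ⟨i, -, rfl⟩ := hJ
    intro v hv
    rw [hr0, Metric.mem_closedBall]
    exact (Metric.dist_le_diam_of_mem (BoxIntegral.Box.isBounded_Icc _) hv hJH).trans
      ((BoxIntegral.unitPartition.diam_boxIcc m _).trans hm)
  have hpart : ∀ z : ℕ → ℝ, (gridPartition m z).IsPartition := fun z =>
    BoxIntegral.unitPartition.prepartition_isPartition m
      ⟨fun _ => 0, fun _ => 1, by simp [unitBox], by simp [unitBox]⟩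
  have key : ∀ z : ℕ → ℝ, IsGridTag m z →
      dist ((m : ℂ)⁻¹ * ∑ i ∈ Finset.range m, f (z i))
        (BoxIntegral.integral unitBox BoxIntegral.IntegrationParams.Riemann
          (fun v : Fin 1 → ℝ => f (v 0)) BoxIntegral.BoxAdditiveMap.volume) ≤ ε / 2 := by
    intro z hz
    rw [← integralSum_gridPartition hz]
    exact BoxIntegral.Integrable.dist_integralSum_integral_le_of_memBaseSet hf (half_pos hε)
      (hmem z hz) (hpart z)
  have h := (dist_triangle_right _ _ _).trans (add_le_add (key x hx) (key y hy))
  rw [add_halves, dist_eq_norm, ← mul_sub, ← Finset.sum_sub_distrib, norm_mul, norm_inv,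
    Complex.norm_natCast] at h
  have hmR : (0 : ℝ) < m := by exact_mod_cast NeZero.pos m
  rwa [inv_mul_le_iff₀ hmR] at h

/-- The mean oscillation of a Riemann integrable function over fine equidistant partitions is
small. -/
theorem RiemannIntegrable.eventually_sum_norm_sub_le {f : ℝ → ℂ} (hf : RiemannIntegrable f)
    {ε : ℝ} (hε : 0 < ε) :
    ∀ᶠ m : ℕ in atTop, ∀ x y : ℕ → ℝ, IsGridTag m x → IsGridTag m y →
      ∑ i ∈ Finset.range m, ‖f (x i) - f (y i)‖ ≤ m * ε := by
  filter_upwards [hf.eventually_norm_sum_sub_le (half_pos hε)] with m hm x y hx hy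
  -- Exchanging x i and y i wherever L of the difference is negative gives admissible tags again and
  -- turns the sum of absolute values into a signed sum. Real and imaginary parts each cost ε / 2.
  have swap : ∀ L : ℂ →ₗ[ℝ] ℝ, (∀ z, |L z| ≤ ‖z‖) →
      ∑ i ∈ Finset.range m, |L (f (x i) - f (y i))| ≤ m * (ε / 2) := by
    intro L hL
    set x' : ℕ → ℝ := fun i => if 0 ≤ L (f (x i) - f (y i)) then x i else y i with hx'
    set y' : ℕ → ℝ := fun i => if 0 ≤ L (f (x i) - f (y i)) then y i else x i with hy'
    have h := hm x' y' (fun i hi => by rw [hx']; dsimp only; split_ifs; exacts [hx i hi, hy i hi])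
      (fun i hi => by rw [hy']; dsimp only; split_ifs; exacts [hy i hi, hx i hi])
    calc ∑ i ∈ Finset.range m, |L (f (x i) - f (y i))|
        = L (∑ i ∈ Finset.range m, (f (x' i) - f (y' i))) := by
          rw [map_sum]
          refine Finset.sum_congr rfl fun i _ => ?_
          by_cases h0 : 0 ≤ L (f (x i) - f (y i))
          · simp only [hx', hy', h0, if_true, abs_of_nonneg]
          · simp only [hx', hy', h0, if_false]
            rw [abs_of_neg (not_le.1 h0), ← map_neg, neg_sub]
      _ ≤ ‖∑ i ∈ Finset.range m, (f (x' i) - f (y' i))‖ := (le_abs_self _).trans (hL _)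
      _ ≤ m * (ε / 2) := h
  have hre := swap Complex.reLm fun z => Complex.abs_re_le_norm z
  have him := swap Complex.imLm fun z => Complex.abs_im_le_norm z
  calc ∑ i ∈ Finset.range m, ‖f (x i) - f (y i)‖
      ≤ ∑ i ∈ Finset.range m, (|Complex.reLm (f (x i) - f (y i))| +
          |Complex.imLm (f (x i) - f (y i))|) :=
        Finset.sum_le_sum fun i _ => Complex.norm_le_abs_re_add_abs_im _
    _ ≤ m * ε := by rw [Finset.sum_add_distrib]; linarith

end KMS

/-! ### Absolutely convergent Fourier series on the circle. -/

namespace KMS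

instance fact_two_pi_pos : Fact (0 < 2 * Real.pi) := ⟨Real.two_pi_pos⟩

/-- The trigonometric series with coefficients `c`. -/
noncomputable def trig (c : ℤ → ℂ) (t : ℝ) : ℂ :=
  ∑' k : ℤ, c k * Complex.exp (Complex.I * k * t)

theorem norm_exp_I_mul_int_mul (k : ℤ) (t : ℝ) : ‖Complex.exp (Complex.I * k * t)‖ = 1 := by
  have : Complex.I * k * t = ((k * t : ℝ) : ℂ) * Complex.I := by push_cast; ring
  rw [this, Complex.norm_exp_ofReal_mul_I]

theorem fourier_two_pi_coe_apply (k : ℤ) (t : ℝ) :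
    fourier k (t : AddCircle (2 * Real.pi)) = Complex.exp (Complex.I * k * t) := by
  rw [fourier_coe_apply]
  congr 1
  have : (Real.pi : ℂ) ≠ 0 := by exact_mod_cast Real.pi_ne_zero
  push_cast
  field_simp

/-- The continuous function on the circle with absolutely summable Fourier coefficients `c`. -/
noncomputable def circleSeries (c : ℤ → ℂ) : C(AddCircle (2 * Real.pi), ℂ) :=
  ∑' k : ℤ, c k • fourier k

variable {c : ℤ → ℂ}

theorem hasSum_circleSeries (hc : Summable fun k => ‖c k‖) :
    HasSum (fun k => c k • (fourier k : C(AddCircle (2 * Real.pi), ℂ))) (circleSeries c) := by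
  refine (Summable.of_norm ?_).hasSum
  simpa [norm_smul, fourier_norm] using hc

theorem circleSeries_coe (hc : Summable fun k => ‖c k‖) (t : ℝ) :
    circleSeries c (t : AddCircle (2 * Real.pi)) = trig c t := by
  have h := ContinuousMap.hasSum_apply (hasSum_circleSeries hc) (t : AddCircle (2 * Real.pi))
  rw [← h.tsum_eq, trig]
  simp only [ContinuousMap.coe_smul, Pi.smul_apply, smul_eq_mul, fourier_two_pi_coe_apply]

theorem norm_trig_le (hc : Summable fun k => ‖c k‖) (t : ℝ) : ‖trig c t‖ ≤ ∑' k, ‖c k‖ := by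
  refine tsum_of_norm_bounded hc.hasSum fun k => ?_
  rw [norm_mul, norm_exp_I_mul_int_mul, mul_one]

theorem hasSum_toLp_circleSeries (hc : Summable fun k => ‖c k‖) :
    HasSum (fun k => c k • fourierLp (T := 2 * Real.pi) 2 k)
      (ContinuousMap.toLp 2 AddCircle.haarAddCircle ℂ (circleSeries c)) := by
  have h := (hasSum_circleSeries hc).mapL
    (ContinuousMap.toLp (E := ℂ) 2 (AddCircle.haarAddCircle (T := 2 * Real.pi)) ℂ)
  simpa using h

/-- Bessel's inequality with the supremum norm. -/
theorem tsum_norm_sq_le_of_norm_trig_le (hc : Summable fun k => ‖c k‖) {s : ℝ}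
    (hs : ∀ t, ‖trig c t‖ ≤ s) : ∑' k, ‖c k‖ ^ 2 ≤ s ^ 2 := by
  have hs0 : 0 ≤ s := (norm_nonneg _).trans (hs 0)
  set G := ContinuousMap.toLp (E := ℂ) 2 (AddCircle.haarAddCircle (T := 2 * Real.pi)) ℂ
    (circleSeries c) with hG
  have hinner : ∀ k, inner ℂ (fourierLp (T := 2 * Real.pi) 2 k) G = c k := by
    intro k
    have h := (hasSum_toLp_circleSeries hc).mapL (innerSL ℂ (fourierLp (T := 2 * Real.pi) 2 k))
    have h' : HasSum (fun j => innerSL ℂ (fourierLp (T := 2 * Real.pi) 2 k)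
        (c j • fourierLp (T := 2 * Real.pi) 2 j)) (c k) := by
      convert hasSum_ite_eq k (c k) using 2 with j
      rw [innerSL_apply_apply, inner_smul_right,
        orthonormal_iff_ite.1 (orthonormal_fourier (T := 2 * Real.pi))]
      by_cases hjk : j = k
      · simp [hjk]
      · simp [hjk, Ne.symm hjk]
    exact h.unique h'
  have hnorm : ‖circleSeries c‖ ≤ s := by
    rw [ContinuousMap.norm_le _ hs0]
    intro θ
    induction θ using QuotientAddGroup.induction_on with
    | H t => rw [circleSeries_coe hc]; exact hs t
  have hGn : ‖G‖ ≤ s := by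
    refine (ContinuousLinearMap.le_opNorm _ _).trans ?_
    refine le_trans (mul_le_mul_of_nonneg_right
      (ContinuousMap.toLp_norm_le (E := ℂ) (𝕜 := ℂ) (p := 2)
        (AddCircle.haarAddCircle (T := 2 * Real.pi))) (norm_nonneg _)) ?_
    simpa [measureUnivNNReal] using hnorm
  have := (orthonormal_fourier (T := 2 * Real.pi)).tsum_inner_products_le G
  simp_rw [hinner] at this
  exact this.trans (by gcongr)

/-- A bounded function whose Fourier coefficients are absolutely summable is almost everywhere the
sum of its Fourier series. -/
theorem ae_eq_trig {f : ℝ → ℂ} (hf : MemLp f ⊤ (volume.restrict (Icc (0 : ℝ) (2 * Real.pi))))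
    (hc : Summable fun k => ‖c k‖)
    (hcoef : ∀ k : ℤ, c k = (1 / (2 * Real.pi : ℂ)) *
      ∫ t in (0 : ℝ)..(2 * Real.pi), f t * Complex.exp (-(Complex.I * k * t))) :
    ∀ᵐ t ∂volume.restrict (Icc (0 : ℝ) (2 * Real.pi)), f t = trig c t := by
  rw [← restrict_Ioc_eq_restrict_Icc] at hf ⊢
  have hf2 : MemLp f 2 (volume.restrict (Ioc (0 : ℝ) (0 + 2 * Real.pi))) := by
    rw [zero_add]
    exact hf.mono_exponent le_top
  have hF := (hf2.memLp_liftIoc).haarAddCircle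
  have hsum := hasSum_fourier_series_L2 hF.toLp
  have hcc : ∀ k, fourierCoeff (hF.toLp : AddCircle (2 * Real.pi) → ℂ) k = c k := by
    intro k
    rw [fourierCoeff_congr_ae hF.coeFn_toLp, fourierCoeff_eq_intervalIntegral _ _ 0, hcoef,
      Complex.real_smul, zero_add]
    congr 1
    · push_cast; rfl
    · simp_rw [intervalIntegral.integral_of_le Real.two_pi_pos.le]
      refine setIntegral_congr_fun measurableSet_Ioc fun t ht => ?_
      rw [AddCircle.liftIoc_coe_apply (by simpa using ht), fourier_two_pi_coe_apply, smul_eq_mul,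
        mul_comm]
      push_cast
      ring_nf
  simp_rw [hcc] at hsum
  -- The lift of f and the continuous function `circleSeries c` are L² sums of the same Fourier
  -- series, so they agree almost everywhere.
  have heq := hsum.unique (hasSum_toLp_circleSeries hc)
  have hae : AddCircle.liftIoc (2 * Real.pi) 0 f =ᵐ[AddCircle.haarAddCircle] circleSeries c := by
    refine hF.coeFn_toLp.symm.trans ?_
    rw [heq]
    exact ContinuousMap.coeFn_toLp _ _
  have hae' : AddCircle.liftIoc (2 * Real.pi) 0 f =ᵐ[volume] circleSeries c := by
    rw [AddCircle.volume_eq_smul_haarAddCircle]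
    exact Measure.ae_smul_measure hae _
  have := (AddCircle.measurePreserving_mk (2 * Real.pi) 0).quasiMeasurePreserving.ae hae'
  rw [zero_add] at this
  filter_upwards [this, ae_restrict_mem measurableSet_Ioc] with t ht htm
  rw [← circleSeries_coe hc, ← AddCircle.liftIoc_coe_apply (a := 0) (f := f) (by simpa using htm)]
  exact ht

end KMS

/-! ### Almost everywhere continuity of the Fourier coefficients. -/

namespace KMS

/-- `‖â_k‖_∞`, as a real number. -/
noncomputable def supCoeff (a : ℝ → ℝ → ℂ) (k : ℤ) : ℝ :=
  (⨆ x ∈ Icc (0 : ℝ) 1, ‖coeff a k x‖ₑ).toReal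

variable {a : ℝ → ℝ → ℂ}

theorem supCoeff_nonneg (k : ℤ) : 0 ≤ supCoeff a k := ENNReal.toReal_nonneg

theorem summable_supCoeff (h : decayNorm a < ⊤) : Summable (supCoeff a) :=
  ENNReal.summable_toReal h.ne

theorem norm_coeff_le_supCoeff (h : decayNorm a < ⊤) (k : ℤ) {x : ℝ} (hx : x ∈ Icc (0 : ℝ) 1) :
    ‖coeff a k x‖ ≤ supCoeff a k := by
  rw [← toReal_enorm]
  refine ENNReal.toReal_mono (ENNReal.ne_top_of_tsum_ne_top h.ne k) ?_
  exact le_iSup₂ (f := fun x (_ : x ∈ Icc (0 : ℝ) 1) => ‖coeff a k x‖ₑ) x hx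

theorem summable_norm_coeff (h : decayNorm a < ⊤) {x : ℝ} (hx : x ∈ Icc (0 : ℝ) 1) :
    Summable fun k => ‖coeff a k x‖ :=
  (summable_supCoeff h).of_nonneg_of_le (fun _ => norm_nonneg _)
    fun k => norm_coeff_le_supCoeff h k hx

theorem norm_trig_coeff_le (h : decayNorm a < ⊤) {x : ℝ} (hx : x ∈ Icc (0 : ℝ) 1) (t : ℝ) :
    ‖trig (fun k => coeff a k x) t‖ ≤ ∑' k, supCoeff a k :=
  (norm_trig_le (summable_norm_coeff h hx) t).trans
    ((summable_norm_coeff h hx).tsum_le_tsum (fun k => norm_coeff_le_supCoeff h k hx)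
      (summable_supCoeff h))

/-- This transfers oscillation of a(·,t), averaged over t, to the coefficients. -/
theorem norm_coeff_sub_le {x y : ℝ}
    (hx : MemLp (fun t => a x t) ⊤ (volume.restrict (Icc (0 : ℝ) (2 * Real.pi))))
    (hy : MemLp (fun t => a y t) ⊤ (volume.restrict (Icc (0 : ℝ) (2 * Real.pi)))) (k : ℤ) :
    ‖coeff a k x - coeff a k y‖ ≤
      (2 * Real.pi)⁻¹ * ∫ t in Icc (0 : ℝ) (2 * Real.pi), ‖a x t - a y t‖ := by
  have hint : ∀ z, MemLp (fun t => a z t) ⊤ (volume.restrict (Icc (0 : ℝ) (2 * Real.pi))) →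
      IntegrableOn (fun t : ℝ => a z t * Complex.exp (-(Complex.I * k * t)))
        (Icc (0 : ℝ) (2 * Real.pi)) := by
    intro z hz
    refine (hz.integrable le_top).mul_bdd (c := 1) ?_ (ae_of_all _ fun t => ?_)
    · exact (by fun_prop : Continuous fun t : ℝ =>
        Complex.exp (-(Complex.I * k * t))).aestronglyMeasurable
    · rw [Complex.exp_neg, norm_inv, norm_exp_I_mul_int_mul, inv_one]
  simp only [coeff]
  rw [intervalIntegral.integral_of_le Real.two_pi_pos.le,
    intervalIntegral.integral_of_le Real.two_pi_pos.le, ← integral_Icc_eq_integral_Ioc,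
    ← integral_Icc_eq_integral_Ioc, ← mul_sub, ← integral_sub (hint x hx) (hint y hy), norm_mul]
  have hn : ‖(1 / (2 * Real.pi : ℂ))‖ = (2 * Real.pi)⁻¹ := by
    rw [one_div, norm_inv]
    norm_num [abs_of_pos Real.pi_pos]
  rw [hn]
  refine mul_le_mul_of_nonneg_left ?_ (by positivity)
  refine (norm_integral_le_integral_norm _).trans (le_of_eq ?_)
  congr 1
  funext t
  rw [← sub_mul, norm_mul, Complex.exp_neg, norm_inv, norm_exp_I_mul_int_mul, inv_one, mul_one]

/-- The mean oscillation of the Fourier coefficients over equidistant partitions tends to zero. -/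
theorem tendsto_sum_norm_coeff_sub
    (ha_x : ∀ t ∈ Icc (0 : ℝ) (2 * Real.pi), RiemannIntegrable (fun x => a x t))
    (ha_t : ∀ x ∈ Icc (0 : ℝ) 1,
      MemLp (fun t => a x t) ⊤ (volume.restrict (Icc (0 : ℝ) (2 * Real.pi))))
    (hdecay : decayNorm a < ⊤) (k : ℤ) (x y : ℕ → ℕ → ℝ) (hx : ∀ m, IsGridTag m (x m))
    (hy : ∀ m, IsGridTag m (y m)) :
    Tendsto (fun m : ℕ => (m : ℝ)⁻¹ *
      ∑ i ∈ Finset.range m, ‖coeff a k (x m i) - coeff a k (y m i)‖) atTop (𝓝 0) := by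
  set μ := volume.restrict (Icc (0 : ℝ) (2 * Real.pi)) with hμ
  set B := ∑' k, supCoeff a k with hB
  -- The L^∞ hypothesis alone gives a bound depending on z. The Fourier series gives one uniform in
  -- z, which serves as the dominating constant; each m involves only finitely many grid points,
  -- hence finitely many null sets.
  have hbound : ∀ z ∈ Icc (0 : ℝ) 1, ∀ᵐ t ∂μ, ‖a z t‖ ≤ B := by
    intro z hz
    filter_upwards [ae_eq_trig (ha_t z hz) (summable_norm_coeff hdecay hz) fun k => rfl] with t ht
    rw [ht]
    exact norm_trig_coeff_le hdecay hz t
  set S : ℕ → ℝ → ℝ := fun m t =>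
    (m : ℝ)⁻¹ * ∑ i ∈ Finset.range m, ‖a (x m i) t - a (y m i) t‖ with hS
  have hmeas : ∀ m, ∀ i < m, AEStronglyMeasurable (fun t => a (x m i) t - a (y m i) t) μ :=
    fun m i hi => (ha_t _ ((hx m).mem_Icc hi)).1.sub (ha_t _ ((hy m).mem_Icc hi)).1
  have hint : ∀ m, ∀ i < m, Integrable (fun t => ‖a (x m i) t - a (y m i) t‖) μ := fun m i hi =>
    (((ha_t _ ((hx m).mem_Icc hi)).integrable le_top).sub
      ((ha_t _ ((hy m).mem_Icc hi)).integrable le_top)).norm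
  have hlim : Tendsto (fun m => ∫ t, S m t ∂μ) atTop (𝓝 (∫ _, (0 : ℝ) ∂μ)) := by
    refine tendsto_integral_of_dominated_convergence (fun _ => 2 * B) (fun m => ?_)
      (integrable_const _) (fun m => ?_) ?_
    · refine (Finset.aestronglyMeasurable_fun_sum _ fun i hi => ?_).const_mul _
      exact (hmeas m i (Finset.mem_range.1 hi)).norm
    · have h : ∀ᵐ t ∂μ, ∀ i ∈ Finset.range m, ‖a (x m i) t‖ ≤ B ∧ ‖a (y m i) t‖ ≤ B := by
        rw [Finset.eventually_all]
        intro i hi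
        rw [Finset.mem_range] at hi
        exact (hbound _ ((hx m).mem_Icc hi)).and (hbound _ ((hy m).mem_Icc hi))
      filter_upwards [h] with t ht
      rw [Real.norm_of_nonneg (by positivity)]
      rcases Nat.eq_zero_or_pos m with rfl | hm
      · have : 0 ≤ B := tsum_nonneg fun k => supCoeff_nonneg k
        simp [hS, this]
      have hm' : (0 : ℝ) < m := by exact_mod_cast hm
      rw [hS]
      dsimp only
      rw [inv_mul_le_iff₀ hm']
      calc ∑ i ∈ Finset.range m, ‖a (x m i) t - a (y m i) t‖ ≤ ∑ i ∈ Finset.range m, 2 * B :=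
            Finset.sum_le_sum fun i hi => (norm_sub_le _ _).trans
              (by linarith [(ht i hi).1, (ht i hi).2])
        _ = m * (2 * B) := by simp
    · filter_upwards [ae_restrict_mem measurableSet_Icc] with t ht
      rw [Metric.tendsto_atTop']
      intro ε hε
      obtain ⟨N, hN⟩ := eventually_atTop.1 ((ha_x t ht).eventually_sum_norm_sub_le (half_pos hε))
      refine ⟨N, fun m hm => ?_⟩
      have h := hN m hm.le (x m) (y m) (hx m) (hy m)
      have hm' : (0 : ℝ) < m := by exact_mod_cast (by omega : 0 < m)
      rw [Real.dist_0_eq_abs, abs_of_nonneg (by positivity), hS]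
      dsimp only
      rw [inv_mul_lt_iff₀ hm']
      exact h.trans_lt (by gcongr; linarith)
  rw [integral_zero] at hlim
  have hlim' := hlim.const_mul (2 * Real.pi)⁻¹
  rw [mul_zero] at hlim'
  refine squeeze_zero (fun m => by positivity) (fun m => ?_) hlim'
  rw [hS]
  dsimp only
  rw [integral_const_mul, integral_finsetSum _ fun i hi => hint m i (Finset.mem_range.1 hi),
    mul_left_comm]
  refine mul_le_mul_of_nonneg_left ?_ (by positivity)
  rw [Finset.mul_sum]
  refine Finset.sum_le_sum fun i hi => ?_
  rw [Finset.mem_range] at hi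
  exact norm_coeff_sub_le (ha_t _ ((hx m).mem_Icc hi)) (ha_t _ ((hy m).mem_Icc hi)) k

/-- A function whose mean oscillation over equidistant partitions of `[0, 1]` tends to zero is
almost everywhere continuous. -/
theorem ae_continuousAt_of_tendsto_sum_norm_sub {f : ℝ → ℂ}
    (hf : ∀ x y : ℕ → ℕ → ℝ, (∀ m, IsGridTag m (x m)) → (∀ m, IsGridTag m (y m)) →
      Tendsto (fun m : ℕ => (m : ℝ)⁻¹ * ∑ i ∈ Finset.range m, ‖f (x m i) - f (y m i)‖)
        atTop (𝓝 0)) :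
    ∀ᵐ x ∂volume.restrict (Ioo (0 : ℝ) 1), ContinuousAt f x := by
  -- An irrational x is interior to its grid cell, so if f oscillates by more than ε near x, it does
  -- so on that cell. Chebyshev bounds the total length of such cells by the mean oscillation
  -- divided by ε, for suitable tags.
  have key : ∀ ε : ℝ, 0 < ε →
      volume {x | x ∈ Ioo (0 : ℝ) 1 ∧ Irrational x ∧ ∀ U ∈ 𝓝 x, ∃ y ∈ U, ∃ z ∈ U,
        ε < ‖f y - f z‖} = 0 := by
    intro ε hε
    set D := {x | x ∈ Ioo (0 : ℝ) 1 ∧ Irrational x ∧ ∀ U ∈ 𝓝 x, ∃ y ∈ U, ∃ z ∈ U,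
        ε < ‖f y - f z‖} with hD
    set P : ℕ → ℕ → Prop := fun m i => ∃ y z : ℝ, y ∈ Icc ((i : ℝ) / m) (((i : ℝ) + 1) / m) ∧
      z ∈ Icc ((i : ℝ) / m) (((i : ℝ) + 1) / m) ∧ ε < ‖f y - f z‖ with hP
    have hchoose : ∀ m i : ℕ, ∃ y z : ℝ, y ∈ Icc ((i : ℝ) / m) (((i : ℝ) + 1) / m) ∧
      z ∈ Icc ((i : ℝ) / m) (((i : ℝ) + 1) / m) ∧ (P m i → ε < ‖f y - f z‖) := by
      intro m i
      by_cases h : P m i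
      · obtain ⟨y, z, hy, hz, hyz⟩ := h
        exact ⟨y, z, hy, hz, fun _ => hyz⟩
      · have : ((i : ℝ) / m) ∈ Icc ((i : ℝ) / m) (((i : ℝ) + 1) / m) :=
          ⟨le_rfl, by gcongr; linarith⟩
        exact ⟨_, _, this, this, fun h' => absurd h' h⟩
    choose x y hx hy hxy using hchoose
    have hlim := hf x y (fun m i _ => hx m i) (fun m i _ => hy m i)
    classical
    have hvol : ∀ m : ℕ, 0 < m → volume D ≤ ENNReal.ofReal (ε⁻¹ * ((m : ℝ)⁻¹ *
        ∑ i ∈ Finset.range m, ‖f (x m i) - f (y m i)‖)) := by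
      intro m hm
      have hm' : (0 : ℝ) < m := by exact_mod_cast hm
      set s := (Finset.range m).filter (P m) with hs
      have hsub : D ⊆ ⋃ i ∈ s, Icc ((i : ℝ) / m) (((i : ℝ) + 1) / m) := by
        rintro w ⟨hw, hirr, hU⟩
        set i := ⌊(m : ℝ) * w⌋₊ with hi
        have hmw : 0 ≤ (m : ℝ) * w := mul_nonneg hm'.le hw.1.le
        have h1 : (i : ℝ) ≤ m * w := Nat.floor_le hmw
        have h2 : (m : ℝ) * w < i + 1 := Nat.lt_floor_add_one _
        have h1' : (i : ℝ) / m < w := by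
          refine lt_of_le_of_ne (by rwa [div_le_iff₀' hm']) fun h => hirr ?_
          exact ⟨(i : ℚ) / m, by rw [← h]; push_cast; rfl⟩
        have h2' : w < ((i : ℝ) + 1) / m := by rwa [lt_div_iff₀' hm']
        have him : i < m := by
          have : (m : ℝ) * w < m := by nlinarith [hw.2]
          exact_mod_cast h1.trans_lt this
        obtain ⟨y, hy, z, hz, hyz⟩ := hU _ (Icc_mem_nhds h1' h2')
        simp only [mem_iUnion]
        exact ⟨i, Finset.mem_filter.2 ⟨Finset.mem_range.2 him, y, z, hy, hz, hyz⟩, h1'.le, h2'.le⟩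
      calc volume D ≤ ∑ i ∈ s, volume (Icc ((i : ℝ) / m) (((i : ℝ) + 1) / m)) :=
            (measure_mono hsub).trans (measure_biUnion_finset_le _ _)
        _ = ENNReal.ofReal (s.card * (m : ℝ)⁻¹) := by
            rw [ENNReal.ofReal_mul (by positivity)]
            simp [Real.volume_Icc, ← sub_div, one_div]
        _ ≤ _ := by
            refine ENNReal.ofReal_le_ofReal ?_
            have : (s.card : ℝ) * ε ≤ ∑ i ∈ Finset.range m, ‖f (x m i) - f (y m i)‖ := by
              calc (s.card : ℝ) * ε = ∑ i ∈ s, ε := by simp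
                _ ≤ ∑ i ∈ s, ‖f (x m i) - f (y m i)‖ :=
                  Finset.sum_le_sum fun i hi => (hxy m i (Finset.mem_filter.1 hi).2).le
                _ ≤ _ := Finset.sum_le_sum_of_subset_of_nonneg (Finset.filter_subset _ _)
                  fun i _ _ => norm_nonneg _
            rw [mul_left_comm, mul_comm]
            refine mul_le_mul_of_nonneg_left ?_ (by positivity)
            rwa [le_inv_mul_iff₀ hε, mul_comm]
    have h0 : Tendsto (fun m : ℕ => ENNReal.ofReal (ε⁻¹ * ((m : ℝ)⁻¹ *
        ∑ i ∈ Finset.range m, ‖f (x m i) - f (y m i)‖))) atTop (𝓝 0) := by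
      have := ENNReal.tendsto_ofReal (hlim.const_mul ε⁻¹)
      simpa using this
    refine le_antisymm (ge_of_tendsto h0 ?_) bot_le
    filter_upwards [eventually_gt_atTop 0] with m hm using hvol m hm
  have hall : ∀ᵐ x, ∀ n : ℕ, ¬ (x ∈ Ioo (0 : ℝ) 1 ∧ Irrational x ∧ ∀ U ∈ 𝓝 x, ∃ y ∈ U, ∃ z ∈ U,
        1 / ((n : ℝ) + 1) < ‖f y - f z‖) := by
    rw [ae_all_iff]
    intro n
    have := key (1 / ((n : ℝ) + 1)) (by positivity)
    rw [ae_iff]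
    simpa only [not_not] using this
  have hirr : ∀ᵐ x : ℝ, Irrational x := by
    have : (range ((↑) : ℚ → ℝ)).Countable := countable_range _
    exact this.ae_notMem _
  rw [ae_restrict_iff' measurableSet_Ioo]
  filter_upwards [hall, hirr] with x hx hxi hx01
  rw [Metric.continuousAt_iff]
  intro ε hε
  obtain ⟨n, hn⟩ := exists_nat_one_div_lt hε
  have := hx n
  push Not at this
  obtain ⟨U, hU, hUf⟩ := this hx01 hxi
  obtain ⟨δ, hδ, hball⟩ := Metric.mem_nhds_iff.1 hU
  refine ⟨δ, hδ, fun y hy => ?_⟩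
  rw [dist_eq_norm]
  exact (hUf y (hball hy) x (mem_of_mem_nhds hU)).trans_lt hn

/-- Almost every point of `[0, 1]` is a point of continuity of all the Fourier coefficients. -/
theorem ae_continuousAt_coeff
    (ha_x : ∀ t ∈ Icc (0 : ℝ) (2 * Real.pi), RiemannIntegrable (fun x => a x t))
    (ha_t : ∀ x ∈ Icc (0 : ℝ) 1,
      MemLp (fun t => a x t) ⊤ (volume.restrict (Icc (0 : ℝ) (2 * Real.pi))))
    (hdecay : decayNorm a < ⊤) :
    ∀ᵐ x ∂volume.restrict (Ioo (0 : ℝ) 1), ∀ k, ContinuousAt (coeff a k) x :=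
  ae_all_iff.2 fun k => ae_continuousAt_of_tendsto_sum_norm_sub fun x y hx hy =>
    tendsto_sum_norm_coeff_sub ha_x ha_t hdecay k x y hx hy

end KMS

/-! ### Convolution powers as Fourier coefficients of powers. -/

namespace KMS

section Convolution

variable {R : Type*} [RCLike R]

/-- The convolution of two sequences on `ℤ`. -/
noncomputable def conv (c d : ℤ → R) (k : ℤ) : R := ∑' l, c l * d (k - l)

/-- The shear `(l, k) ↦ (l, k - l)`. -/
def shear : ℤ × ℤ ≃ ℤ × ℤ := Equiv.prodShear (Equiv.refl ℤ) fun l => Equiv.subRight l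

theorem summable_norm_mul_shear {c d : ℤ → R} (hc : Summable fun k => ‖c k‖)
    (hd : Summable fun k => ‖d k‖) : Summable fun p : ℤ × ℤ => ‖c p.1 * d (p.2 - p.1)‖ := by
  have h := hc.mul_norm hd
  exact (shear.summable_iff (f := fun p : ℤ × ℤ => ‖c p.1 * d p.2‖)).2 h

theorem summable_norm_mul_shear_left {c d : ℤ → R} (hc : Summable fun k => ‖c k‖)
    (hd : Summable fun k => ‖d k‖) (k : ℤ) : Summable fun l => ‖c l * d (k - l)‖ :=
  (summable_norm_mul_shear hc hd).prod_symm.prod_factor k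

theorem summable_norm_conv {c d : ℤ → R} (hc : Summable fun k => ‖c k‖)
    (hd : Summable fun k => ‖d k‖) : Summable fun k => ‖conv c d k‖ :=
  (summable_norm_mul_shear hc hd).prod_symm.prod.of_nonneg_of_le (fun _ => norm_nonneg _)
    fun k => norm_tsum_le_tsum_norm (summable_norm_mul_shear_left hc hd k)

/-- The convolution powers of a sequence. -/
noncomputable def convPow (c : ℤ → R) : ℕ → ℤ → R
  | 0 => Pi.single 0 1
  | m + 1 => conv (convPow c m) c

theorem summable_norm_convPow {c : ℤ → R} (hc : Summable fun k => ‖c k‖) (m : ℕ) :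
    Summable fun k => ‖convPow c m k‖ := by
  induction m with
  | zero =>
    refine summable_of_ne_finset_zero (s := {0}) fun k hk => ?_
    simp only [Finset.mem_singleton] at hk
    simp [convPow, hk]
  | succ m ih => exact summable_norm_conv ih hc

end Convolution

theorem convPow_nonneg {h : ℤ → ℝ} (hh : ∀ k, 0 ≤ h k) (m : ℕ) (k : ℤ) : 0 ≤ convPow h m k := by
  induction m generalizing k with
  | zero =>
    by_cases hk : k = 0
    · simp [convPow, hk]
    · simp [convPow, hk]
  | succ m ih => exact tsum_nonneg fun l => mul_nonneg (ih l) (hh _)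

/-- Since e^{ilt} e^{i(k−l)t} = e^{ikt}, this is a Cauchy product over ℤ: absolute summability
permits exchanging the sums, and the shear separates the variables. -/
theorem trig_conv {c d : ℤ → ℂ} (hc : Summable fun k => ‖c k‖) (hd : Summable fun k => ‖d k‖)
    (t : ℝ) : trig (conv c d) t = trig c t * trig d t := by
  set e : ℤ → ℂ := fun k => Complex.exp (Complex.I * k * t) with he
  have hen : ∀ k, ‖e k‖ = 1 := fun k => norm_exp_I_mul_int_mul k t
  have hec : Summable fun k => ‖c k * e k‖ := by simpa [hen] using hc
  have hed : Summable fun k => ‖d k * e k‖ := by simpa [hen] using hd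
  have hadd : ∀ l k, e l * e (k - l) = e k := by
    intro l k
    rw [he]
    dsimp only
    rw [← Complex.exp_add]
    congr 1
    push_cast
    ring
  have hs := (summable_norm_mul_shear hec hed).of_norm
  have hswap := (summable_norm_mul_shear hec hed).prod_symm.of_norm
  calc trig (conv c d) t = ∑' k, ∑' l, (c l * e l) * (d (k - l) * e (k - l)) := by
        refine tsum_congr fun k => ?_
        rw [conv, ← tsum_mul_right]
        refine tsum_congr fun l => ?_
        rw [← show e l * e (k - l) = Complex.exp (Complex.I * k * t) from hadd l k]
        ring
    _ = ∑' p : ℤ × ℤ, (c p.2 * e p.2) * (d (p.1 - p.2) * e (p.1 - p.2)) := hswap.tsum_prod.symm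
    _ = ∑' p : ℤ × ℤ, (c p.1 * e p.1) * (d (p.2 - p.1) * e (p.2 - p.1)) :=
        (Equiv.prodComm ℤ ℤ).tsum_eq
          (fun p : ℤ × ℤ => (c p.1 * e p.1) * (d (p.2 - p.1) * e (p.2 - p.1)))
    _ = ∑' p : ℤ × ℤ, (c p.1 * e p.1) * (d p.2 * e p.2) :=
        shear.tsum_eq (fun p : ℤ × ℤ => (c p.1 * e p.1) * (d p.2 * e p.2))
    _ = trig c t * trig d t := (tsum_mul_tsum_of_summable_norm hec hed).symm

theorem trig_convPow {c : ℤ → ℂ} (hc : Summable fun k => ‖c k‖) (m : ℕ) (t : ℝ) :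
    trig (convPow c m) t = trig c t ^ m := by
  induction m with
  | zero =>
    rw [trig, tsum_eq_single 0]
    · simp [convPow]
    · intro k hk
      simp [convPow, hk]
  | succ m ih =>
    rw [pow_succ, ← ih]
    exact trig_conv (summable_norm_convPow hc m) hc t

/-- The Fourier coefficients of `p ∘ g` if `g` has Fourier coefficients `c`. -/
noncomputable def polyConv (p : Polynomial ℂ) (c : ℤ → ℂ) (k : ℤ) : ℂ :=
  ∑ m ∈ Finset.range (p.natDegree + 1), p.coeff m * convPow c m k

theorem summable_norm_polyConv (p : Polynomial ℂ) {c : ℤ → ℂ} (hc : Summable fun k => ‖c k‖) :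
    Summable fun k => ‖polyConv p c k‖ := by
  refine (summable_sum (s := Finset.range (p.natDegree + 1))
    (f := fun m k => ‖p.coeff m * convPow c m k‖) fun m _ => ?_).of_nonneg_of_le
    (fun _ => norm_nonneg _) fun k => norm_sum_le _ _
  simp_rw [norm_mul]
  exact (summable_norm_convPow hc m).mul_left _

theorem trig_polyConv (p : Polynomial ℂ) {c : ℤ → ℂ} (hc : Summable fun k => ‖c k‖) (t : ℝ) :
    trig (polyConv p c) t = p.eval (trig c t) := by
  rw [Polynomial.eval_eq_sum_range, trig]
  simp_rw [← trig_convPow hc, polyConv, Finset.sum_mul, trig, ← tsum_mul_left, mul_assoc]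
  refine Summable.tsum_finsetSum fun m _ => Summable.mul_left _ (Summable.of_norm ?_)
  refine (summable_norm_convPow hc m).congr fun k => ?_
  rw [norm_mul, ← mul_assoc Complex.I, norm_exp_I_mul_int_mul, mul_one]

/-! ### Polynomials in matrices with summable diagonal bounds, and their row limits. -/

section Extension

/-- The extension of an `N × N` matrix by zero to a matrix indexed by `ℤ`. -/
def extend {N : ℕ} (S : Matrix (Fin N) (Fin N) ℂ) (i j : ℤ) : ℂ :=
  if h : (0 ≤ i ∧ i < N) ∧ (0 ≤ j ∧ j < N) then
    S ⟨i.toNat, by omega⟩ ⟨j.toNat, by omega⟩ else 0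

variable {N : ℕ}

theorem extend_natCast (S : Matrix (Fin N) (Fin N) ℂ) (i j : Fin N) :
    extend S ((i : ℕ) : ℤ) ((j : ℕ) : ℤ) = S i j := by
  have hi := i.2
  have hj := j.2
  rw [extend, dif_pos (by omega)]
  simp

theorem extend_of_left {S : Matrix (Fin N) (Fin N) ℂ} {i j : ℤ} (hi : ¬ (0 ≤ i ∧ i < N)) :
    extend S i j = 0 := dif_neg fun h => hi h.1

theorem extend_of_right {S : Matrix (Fin N) (Fin N) ℂ} {i j : ℤ} (hj : ¬ (0 ≤ j ∧ j < N)) :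
    extend S i j = 0 := dif_neg fun h => hj h.2

theorem tsum_int_eq_sum_fin {E : Type*} [AddCommMonoid E] [TopologicalSpace E] {g : ℤ → E}
    (hg : ∀ l : ℤ, ¬ (0 ≤ l ∧ l < N) → g l = 0) : ∑' l, g l = ∑ j : Fin N, g ((j : ℕ) : ℤ) := by
  have hinj : Function.Injective fun j : Fin N => ((j : ℕ) : ℤ) := fun i j h => by
    ext; simpa using h
  rw [← tsum_fintype (L := .unconditional _)]
  refine (hinj.tsum_eq fun l hl => ?_).symm
  by_contra h
  refine hl (hg l fun hl' => h ⟨⟨l.toNat, by omega⟩, ?_⟩)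
  simp [hl'.1]

/-- Zero padding turns the matrix product into a sum over all of ℤ, so that index shifts need no
boundary cases. -/
theorem extend_mul (S T : Matrix (Fin N) (Fin N) ℂ) (i j : ℤ) :
    extend (S * T) i j = ∑' l, extend S i l * extend T l j := by
  rw [tsum_int_eq_sum_fin (N := N) fun l hl => by rw [extend_of_right hl, zero_mul]]
  by_cases hi : 0 ≤ i ∧ i < N
  · by_cases hj : 0 ≤ j ∧ j < N
    · obtain ⟨i, rfl⟩ : ∃ i' : Fin N, ((i' : ℕ) : ℤ) = i := ⟨⟨i.toNat, by omega⟩, by simp [hi.1]⟩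
      obtain ⟨j, rfl⟩ : ∃ j' : Fin N, ((j' : ℕ) : ℤ) = j := ⟨⟨j.toNat, by omega⟩, by simp [hj.1]⟩
      simp_rw [extend_natCast, Matrix.mul_apply]
    · simp [extend_of_right hj]
  · simp [extend_of_left hi]

theorem extend_one (i j : ℤ) :
    extend (1 : Matrix (Fin N) (Fin N) ℂ) i j = if (0 ≤ i ∧ i < N) ∧ i = j then 1 else 0 := by
  by_cases hi : 0 ≤ i ∧ i < N
  · by_cases hj : 0 ≤ j ∧ j < N
    · rw [extend, dif_pos ⟨hi, hj⟩, Matrix.one_apply]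
      have : ((⟨i.toNat, by omega⟩ : Fin N) = ⟨j.toNat, by omega⟩) ↔ i = j := by
        rw [Fin.mk.injEq]; omega
      simp [this, hi]
    · rw [extend_of_right hj, if_neg]
      rintro ⟨h, rfl⟩
      exact hj h
  · rw [extend_of_left hi, if_neg fun h => hi h.1]

theorem extend_aeval (S : Matrix (Fin N) (Fin N) ℂ) (p : Polynomial ℂ) (i j : ℤ) :
    extend (Polynomial.aeval S p) i j =
      ∑ m ∈ Finset.range (p.natDegree + 1), p.coeff m * extend (S ^ m) i j := by
  rw [Polynomial.aeval_eq_sum_range]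
  by_cases h : (0 ≤ i ∧ i < N) ∧ (0 ≤ j ∧ j < N)
  · simp only [extend, dif_pos h, Matrix.sum_apply, Matrix.smul_apply, smul_eq_mul]
  · simp [extend, dif_neg h]

theorem sum_norm_sq_row_eq_tsum (S : Matrix (Fin N) (Fin N) ℂ) (i : Fin N) :
    ∑ j, ‖S i j‖ ^ 2 = ∑' k : ℤ, ‖extend S ((i : ℕ) : ℤ) (((i : ℕ) : ℤ) + k)‖ ^ 2 := by
  have hshift := (Equiv.addLeft ((i : ℕ) : ℤ)).tsum_eq fun j => ‖extend S ((i : ℕ) : ℤ) j‖ ^ 2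
  simp only [Equiv.coe_addLeft] at hshift
  rw [hshift, tsum_int_eq_sum_fin (N := N) fun l hl => by simp [extend_of_right hl]]
  simp_rw [extend_natCast]

variable {h : ℤ → ℝ}

/-- Multiplying matrices convolves their diagonal bounds. The resulting majorant is summable and
independent of the size N, so it can dominate limits in n. -/
theorem norm_extend_pow_le (hh : Summable h) (h0 : ∀ k, 0 ≤ h k) {S : Matrix (Fin N) (Fin N) ℂ}
    (hS : ∀ i j, ‖extend S i j‖ ≤ h (j - i)) (m : ℕ) (i j : ℤ) :
    ‖extend (S ^ m) i j‖ ≤ convPow h m (j - i) := by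
  have hhn : Summable fun k => ‖h k‖ := hh.norm
  induction m generalizing i j with
  | zero =>
    rw [pow_zero, extend_one]
    by_cases hij : i = j
    · subst hij
      simp only [sub_self, convPow, Pi.single_eq_same, and_true]
      split_ifs <;> simp
    · simp [hij, convPow, sub_ne_zero.2 (Ne.symm hij)]
  | succ m ih =>
    rw [pow_succ, extend_mul, ← (Equiv.addLeft i).tsum_eq]
    refine tsum_of_norm_bounded
      ((summable_norm_mul_shear_left (summable_norm_convPow hhn m) hhn (j - i)).of_norm.hasSum)
      fun l => ?_
    rw [norm_mul, Equiv.coe_addLeft]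
    have h1 := ih i (i + l)
    have h2 := hS (i + l) j
    rw [add_sub_cancel_left] at h1
    rw [← sub_sub] at h2
    exact mul_le_mul h1 h2 (norm_nonneg _) (convPow_nonneg h0 m l)

variable {T : ∀ n : ℕ, Matrix (Fin (n + 1)) (Fin (n + 1)) ℂ} {c : ℤ → ℂ} {ι : ∀ n, Fin (n + 1)}

/-- If the entries of a sequence of matrices converge along the diagonals near the rows `ι n`, then
so do the entries of their powers. -/
theorem tendsto_extend_pow (hh : Summable h) (h0 : ∀ k, 0 ≤ h k)
    (hT : ∀ n i j, ‖extend (T n) i j‖ ≤ h (j - i))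
    (hlim : ∀ l k : ℤ, Tendsto (fun n => extend (T n) (((ι n : ℕ) : ℤ) + l) (((ι n : ℕ) : ℤ) + k))
      atTop (𝓝 (c (k - l)))) (m : ℕ) (k : ℤ) :
    Tendsto (fun n => extend (T n ^ m) ((ι n : ℕ) : ℤ) (((ι n : ℕ) : ℤ) + k)) atTop
      (𝓝 (convPow c m k)) := by
  have hhn : Summable fun k => ‖h k‖ := hh.norm
  induction m generalizing k with
  | zero =>
    refine tendsto_const_nhds.congr fun n => ?_
    have hi := (ι n).2
    rw [pow_zero, extend_one]
    by_cases hk : k = 0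
    · subst hk
      rw [if_pos ⟨by omega, by simp⟩]
      simp [convPow]
    · rw [if_neg (by omega)]
      simp [convPow, hk]
  | succ m ih =>
    have heq : ∀ n, extend (T n ^ (m + 1)) ((ι n : ℕ) : ℤ) (((ι n : ℕ) : ℤ) + k) =
        ∑' l, extend (T n ^ m) ((ι n : ℕ) : ℤ) (((ι n : ℕ) : ℤ) + l) *
          extend (T n) (((ι n : ℕ) : ℤ) + l) (((ι n : ℕ) : ℤ) + k) := fun n => by
      rw [pow_succ, extend_mul, ← (Equiv.addLeft ((ι n : ℕ) : ℤ)).tsum_eq]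
      rfl
    simp_rw [heq]
    refine tendsto_tsum_of_dominated_convergence
      (bound := fun l => convPow h m l * h (k - l))
      (summable_norm_mul_shear_left (summable_norm_convPow hhn m) hhn k).of_norm
      (fun l => (ih l).mul (hlim l k)) (Eventually.of_forall fun n l => ?_)
    rw [norm_mul]
    have h1 := norm_extend_pow_le hh h0 (hT n) m ((ι n : ℕ) : ℤ) (((ι n : ℕ) : ℤ) + l)
    have h2 := hT n (((ι n : ℕ) : ℤ) + l) (((ι n : ℕ) : ℤ) + k)
    rw [add_sub_cancel_left] at h1
    rw [add_sub_add_left_eq_sub] at h2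
    exact mul_le_mul h1 h2 (norm_nonneg _) (convPow_nonneg h0 m l)

/-- A bound for the diagonals of a polynomial in a matrix whose diagonals are bounded by `h`. -/
noncomputable def polyBound (p : Polynomial ℂ) (h : ℤ → ℝ) (k : ℤ) : ℝ :=
  ∑ m ∈ Finset.range (p.natDegree + 1), ‖p.coeff m‖ * convPow h m k

theorem polyBound_nonneg (p : Polynomial ℂ) (h0 : ∀ k, 0 ≤ h k) (k : ℤ) : 0 ≤ polyBound p h k :=
  Finset.sum_nonneg fun m _ => mul_nonneg (norm_nonneg _) (convPow_nonneg h0 m k)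

theorem summable_polyBound_sq (p : Polynomial ℂ) (hh : Summable h) (h0 : ∀ k, 0 ≤ h k) :
    Summable fun k => polyBound p h k ^ 2 := by
  have hs : Summable (polyBound p h) := summable_sum fun m _ =>
    ((summable_norm_convPow hh.norm m).of_norm).mul_left _
  have hb : ∀ k, polyBound p h k ≤ ∑' l, polyBound p h l := fun k =>
    hs.le_tsum k fun l _ => polyBound_nonneg p h0 l
  refine (hs.mul_left (∑' l, polyBound p h l)).of_nonneg_of_le (fun k => sq_nonneg _) fun k => ?_
  rw [sq]
  exact mul_le_mul_of_nonneg_right (hb k) (polyBound_nonneg p h0 k)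

theorem norm_extend_aeval_le (p : Polynomial ℂ) (hh : Summable h) (h0 : ∀ k, 0 ≤ h k)
    {S : Matrix (Fin N) (Fin N) ℂ} (hS : ∀ i j, ‖extend S i j‖ ≤ h (j - i)) (i j : ℤ) :
    ‖extend (Polynomial.aeval S p) i j‖ ≤ polyBound p h (j - i) := by
  rw [extend_aeval]
  refine (norm_sum_le _ _).trans (Finset.sum_le_sum fun m _ => ?_)
  rw [norm_mul]
  exact mul_le_mul_of_nonneg_left (norm_extend_pow_le hh h0 hS m i j) (norm_nonneg _)

/-- The bound is uniform in the size and in the row; it later dominates the average over rows. -/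
theorem sum_norm_sq_row_aeval_le (p : Polynomial ℂ) (hh : Summable h) (h0 : ∀ k, 0 ≤ h k)
    {S : Matrix (Fin N) (Fin N) ℂ} (hS : ∀ i j, ‖extend S i j‖ ≤ h (j - i)) (i : Fin N) :
    ∑ j, ‖Polynomial.aeval S p i j‖ ^ 2 ≤ ∑' k, polyBound p h k ^ 2 := by
  have hs := summable_polyBound_sq p hh h0
  have hb : ∀ k, ‖extend (Polynomial.aeval S p) ((i : ℕ) : ℤ) (((i : ℕ) : ℤ) + k)‖ ^ 2 ≤
      polyBound p h k ^ 2 := fun k => by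
    have := norm_extend_aeval_le p hh h0 hS ((i : ℕ) : ℤ) (((i : ℕ) : ℤ) + k)
    rw [add_sub_cancel_left] at this
    gcongr
  rw [sum_norm_sq_row_eq_tsum]
  exact (hs.of_nonneg_of_le (fun _ => sq_nonneg _) hb).tsum_le_tsum hb hs

/-- Near row `ι n` the matrices converge to the Laurent matrix with symbol `trig c`. Applying p to a
Laurent matrix applies p to the symbol, and the squared norm of a row is the sum of the squared
moduli of the Fourier coefficients. -/
theorem tendsto_sum_norm_sq_row_aeval (p : Polynomial ℂ) (hh : Summable h) (h0 : ∀ k, 0 ≤ h k)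
    (hT : ∀ n i j, ‖extend (T n) i j‖ ≤ h (j - i))
    (hlim : ∀ l k : ℤ, Tendsto (fun n => extend (T n) (((ι n : ℕ) : ℤ) + l) (((ι n : ℕ) : ℤ) + k))
      atTop (𝓝 (c (k - l)))) :
    Tendsto (fun n => ∑ j, ‖Polynomial.aeval (T n) p (ι n) j‖ ^ 2) atTop
      (𝓝 (∑' k, ‖polyConv p c k‖ ^ 2)) := by
  simp_rw [sum_norm_sq_row_eq_tsum]
  refine tendsto_tsum_of_dominated_convergence (bound := fun k => polyBound p h k ^ 2)
    (summable_polyBound_sq p hh h0) (fun k => ?_) (Eventually.of_forall fun n k => ?_)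
  · simp_rw [extend_aeval, polyConv]
    exact ((tendsto_finsetSum _ fun m _ =>
      (tendsto_extend_pow hh h0 hT hlim m k).const_mul _).norm).pow 2
  · have := norm_extend_aeval_le p hh h0 (hT n) ((ι n : ℕ) : ℤ) (((ι n : ℕ) : ℤ) + k)
    rw [add_sub_cancel_left] at this
    rw [norm_pow, norm_norm]
    gcongr

end Extension

end KMS

/-! ### Asymptotics of the Frobenius norm of p(T_n(a)). -/

namespace KMS

variable {a : ℝ → ℝ → ℂ}

theorem extend_matrix {n : ℕ} {i j : ℤ} (hi : 0 ≤ i ∧ i < n + 1) (hj : 0 ≤ j ∧ j < n + 1) :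
    extend (matrix a n) i j = coeff a (j - i) (((i : ℝ) + j) / (2 * n + 2)) := by
  obtain ⟨i, rfl⟩ := Int.eq_ofNat_of_zero_le hi.1
  obtain ⟨j, rfl⟩ := Int.eq_ofNat_of_zero_le hj.1
  rw [extend, dif_pos (by push_cast; exact ⟨hi, hj⟩)]
  simp [matrix]

theorem norm_extend_matrix_le (hdecay : decayNorm a < ⊤) (n : ℕ) (i j : ℤ) :
    ‖extend (matrix a n) i j‖ ≤ supCoeff a (j - i) := by
  by_cases hi : 0 ≤ i ∧ i < n + 1
  · by_cases hj : 0 ≤ j ∧ j < n + 1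
    · rw [extend_matrix hi hj]
      refine norm_coeff_le_supCoeff hdecay _ ⟨?_, ?_⟩
      · have h1 : (0 : ℝ) ≤ i := by exact_mod_cast hi.1
        have h2 : (0 : ℝ) ≤ j := by exact_mod_cast hj.1
        positivity
      · rw [div_le_one (by positivity)]
        have h1 : (i : ℝ) < n + 1 := by exact_mod_cast hi.2
        have h2 : (j : ℝ) < n + 1 := by exact_mod_cast hj.2
        linarith
    · rw [extend_of_right (by push_cast; exact hj), norm_zero]
      exact supCoeff_nonneg _
  · rw [extend_of_left (by push_cast; exact hi), norm_zero]
    exact supCoeff_nonneg _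

theorem floor_mul_lt {x : ℝ} (hx : x ∈ Ico (0 : ℝ) 1) (n : ℕ) :
    ⌊x * ((n : ℝ) + 1)⌋₊ < n + 1 := by
  rw [Nat.floor_lt (by have := hx.1; positivity)]
  push_cast
  nlinarith [hx.2, (Nat.cast_nonneg n : (0 : ℝ) ≤ n)]

theorem tendsto_floor_add_div {x : ℝ} (hx : 0 ≤ x) (l : ℤ) :
    Tendsto (fun n : ℕ => ((⌊x * ((n : ℝ) + 1)⌋₊ : ℝ) + l) / ((n : ℝ) + 1)) atTop (𝓝 x) := by
  have hn : Tendsto (fun n : ℕ => (n : ℝ) + 1) atTop atTop :=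
    tendsto_natCast_atTop_atTop.atTop_add tendsto_const_nhds
  have h1 := (tendsto_nat_floor_mul_div_atTop hx).comp hn
  have h2 : Tendsto (fun n : ℕ => (l : ℝ) / ((n : ℝ) + 1)) atTop (𝓝 0) := hn.const_div_atTop _
  simpa [add_div] using h1.add h2

/-- Near the row `⌊x (n + 1)⌋`, the matrix `T_n(a)` looks like the Laurent matrix of `a(x, ·)`. -/
theorem tendsto_extend_matrix {x : ℝ} (hx : x ∈ Ioo (0 : ℝ) 1)
    (hcont : ∀ k, ContinuousAt (coeff a k) x) (l k : ℤ) :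
    Tendsto (fun n : ℕ => extend (matrix a n) ((⌊x * ((n : ℝ) + 1)⌋₊ : ℤ) + l)
      ((⌊x * ((n : ℝ) + 1)⌋₊ : ℤ) + k)) atTop (𝓝 (coeff a (k - l) x)) := by
  have hl := tendsto_floor_add_div hx.1.le l
  have hk := tendsto_floor_add_div hx.1.le k
  have hrange : ∀ j : ℤ, ∀ᶠ n : ℕ in atTop, 0 ≤ (⌊x * ((n : ℝ) + 1)⌋₊ : ℤ) + j ∧
      (⌊x * ((n : ℝ) + 1)⌋₊ : ℤ) + j < n + 1 := by
    intro j
    filter_upwards [(tendsto_floor_add_div hx.1.le j).eventually (Ioo_mem_nhds hx.1 hx.2)]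
      with n hn
    have hn1 : (0 : ℝ) < (n : ℝ) + 1 := by positivity
    have h1 := (div_pos_iff_of_pos_right hn1).1 hn.1
    have h2 := (div_lt_one hn1).1 hn.2
    exact ⟨by exact_mod_cast h1.le, by exact_mod_cast h2⟩
  -- The sampling point (i + j) / (2n + 2) is the mean of i / (n + 1) and j / (n + 1), both of which
  -- tend to x.
  have harg := (hl.add hk).div_const 2
  rw [add_self_div_two] at harg
  refine ((hcont (k - l)).tendsto.comp harg).congr' ?_
  filter_upwards [hrange l, hrange k] with n h1 h2
  rw [extend_matrix h1 h2, Function.comp_apply]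
  congr 1
  · ring
  · push_cast
    have hn1 : (n : ℝ) + 1 ≠ 0 := by positivity
    have hn2 : 2 * (n : ℝ) + 2 ≠ 0 := by positivity
    field_simp

/-- The map x ↦ ⌊x(n+1)⌋ takes each value i ≤ n on an interval of length 1/(n+1); row averages
become integrals over one fixed interval. -/
theorem setIntegral_comp_floor_mul (n : ℕ) (g : ℕ → ℝ) :
    ∫ x in Ico (0 : ℝ) 1, g ⌊x * ((n : ℝ) + 1)⌋₊ =
      ((n : ℝ) + 1)⁻¹ * ∑ i ∈ Finset.range (n + 1), g i := by
  have hn1 : (0 : ℝ) < (n : ℝ) + 1 := by positivity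
  have hmem : ∀ (i : ℕ) (x : ℝ), x ∈ Ico ((i : ℝ) / (n + 1)) (((i : ℝ) + 1) / (n + 1)) ↔
      0 ≤ x ∧ ⌊x * ((n : ℝ) + 1)⌋₊ = i := by
    intro i x
    rw [mem_Ico, div_le_iff₀ hn1, lt_div_iff₀ hn1]
    constructor
    · intro h
      have h0 : 0 ≤ x * ((n : ℝ) + 1) := (Nat.cast_nonneg i).trans h.1
      exact ⟨nonneg_of_mul_nonneg_left h0 hn1, (Nat.floor_eq_iff h0).2 h⟩
    · rintro ⟨h0, h⟩
      exact (Nat.floor_eq_iff (by positivity)).1 h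
  have hunion : Ico (0 : ℝ) 1 =
      ⋃ i ∈ Finset.range (n + 1), Ico ((i : ℝ) / (n + 1)) (((i : ℝ) + 1) / (n + 1)) := by
    ext x
    simp only [mem_iUnion, hmem, Finset.mem_range, exists_prop]
    constructor
    · intro hx
      exact ⟨_, floor_mul_lt hx n, hx.1, rfl⟩
    · rintro ⟨i, hi, hx0, rfl⟩
      refine ⟨hx0, ?_⟩
      rw [Nat.floor_lt (by positivity)] at hi
      push_cast at hi
      by_contra h
      nlinarith
  have hconst : ∀ i, EqOn (fun x : ℝ => g ⌊x * ((n : ℝ) + 1)⌋₊) (fun _ => g i)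
      (Ico ((i : ℝ) / (n + 1)) (((i : ℝ) + 1) / (n + 1))) := fun i x hx => by
    simp only [((hmem i x).1 hx).2]
  rw [hunion, integral_biUnion_finset _ (fun i _ => measurableSet_Ico), Finset.mul_sum]
  · refine Finset.sum_congr rfl fun i _ => ?_
    rw [setIntegral_congr_fun measurableSet_Ico (hconst i), setIntegral_const]
    rw [Measure.real, Real.volume_Ico, ← sub_div, add_sub_cancel_left,
      ENNReal.toReal_ofReal (by positivity), smul_eq_mul, one_div]
  · intro i _ j _ hij
    refine Set.disjoint_left.2 fun x hxi hxj => hij ?_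
    rw [← ((hmem i x).1 hxi).2, ((hmem j x).1 hxj).2]
  · intro i _
    refine IntegrableOn.congr_fun ?_ (hconst i).symm measurableSet_Ico
    exact integrableOn_const (by simp)

/-- If bounded functions on the grid tend to zero along `⌊x (n + 1)⌋` for almost every `x`, then
their means tend to zero. -/
theorem tendsto_mean_zero {g : ℕ → ℕ → ℝ} {C : ℝ} (hg : ∀ n i, ‖g n i‖ ≤ C)
    (hlim : ∀ᵐ x ∂volume.restrict (Ioo (0 : ℝ) 1),
      Tendsto (fun n : ℕ => g n ⌊x * ((n : ℝ) + 1)⌋₊) atTop (𝓝 0)) :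
    Tendsto (fun n : ℕ => ((n : ℝ) + 1)⁻¹ * ∑ i ∈ Finset.range (n + 1), g n i) atTop (𝓝 0) := by
  simp_rw [← setIntegral_comp_floor_mul]
  rw [Measure.restrict_congr_set Ioo_ae_eq_Ico] at hlim
  have h := tendsto_integral_of_dominated_convergence (fun _ => C) (fun n => ?_)
    (integrable_const _) (fun n => ae_of_all _ fun x => hg n _) hlim
  · simpa using h
  have : Measurable fun x : ℝ => g n ⌊x * ((n : ℝ) + 1)⌋₊ :=
    (measurable_from_nat (f := g n)).comp (Nat.measurable_floor.comp (by fun_prop))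
  exact this.aestronglyMeasurable

/-- The Frobenius norm of `p(T_n(a))` is asymptotically bounded by the supremum norm of
`p ∘ a`. -/
theorem eventually_sum_norm_sq_aeval_le
    (ha_x : ∀ t ∈ Icc (0 : ℝ) (2 * Real.pi), RiemannIntegrable (fun x => a x t))
    (ha_t : ∀ x ∈ Icc (0 : ℝ) 1,
      MemLp (fun t => a x t) ⊤ (volume.restrict (Icc (0 : ℝ) (2 * Real.pi))))
    (hdecay : decayNorm a < ⊤) (p : Polynomial ℂ) {s : ℝ}
    (hs : ∀ᵐ x ∂volume.restrict (Ioo (0 : ℝ) 1), ∀ t,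
      ‖p.eval (trig (fun k => coeff a k x) t)‖ ≤ s) {ε : ℝ} (hε : 0 < ε) :
    ∀ᶠ n : ℕ in atTop, ∑ i, ∑ j, ‖Polynomial.aeval (matrix a n) p i j‖ ^ 2 ≤
      (s ^ 2 + ε) * ((n : ℝ) + 1) := by
  have hsum := summable_supCoeff hdecay
  have h0 : ∀ k, 0 ≤ supCoeff a k := supCoeff_nonneg
  have hT := norm_extend_matrix_le hdecay
  set F : ∀ n : ℕ, Fin (n + 1) → ℝ := fun n i =>
    ∑ j, ‖Polynomial.aeval (matrix a n) p i j‖ ^ 2 with hF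
  set C := ∑' k, polyBound p (supCoeff a) k ^ 2 with hC
  have hFC : ∀ n i, F n i ≤ C := fun n i => sum_norm_sq_row_aeval_le p hsum h0 (hT n) i
  have hC0 : 0 ≤ C := tsum_nonneg fun k => sq_nonneg _
  -- Only an upper bound is sought, so `g` keeps the positive part of the excess over s². Its limit
  -- at a.e. x is 0 because the limiting row norm is at most s².
  set g : ℕ → ℕ → ℝ := fun n i =>
    if h : i < n + 1 then max (F n ⟨i, h⟩ - s ^ 2) 0 else 0 with hg
  have hgC : ∀ n i, ‖g n i‖ ≤ C := by
    intro n i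
    rw [hg]
    dsimp only
    split_ifs with h
    · rw [Real.norm_of_nonneg (le_max_right _ _)]
      exact max_le (by linarith [hFC n ⟨i, h⟩, sq_nonneg s]) hC0
    · simpa using hC0
  have hlim : ∀ᵐ x ∂volume.restrict (Ioo (0 : ℝ) 1),
      Tendsto (fun n : ℕ => g n ⌊x * ((n : ℝ) + 1)⌋₊) atTop (𝓝 0) := by
    filter_upwards [ae_continuousAt_coeff ha_x ha_t hdecay, hs, ae_restrict_mem measurableSet_Ioo]
      with x hcont hxs hx
    have hx' : x ∈ Ico (0 : ℝ) 1 := Ioo_subset_Ico_self hx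
    have hc := summable_norm_coeff hdecay (Ioo_subset_Icc_self hx)
    have h1 := tendsto_sum_norm_sq_row_aeval (T := matrix a) (c := fun k => coeff a k x)
      (ι := fun n => ⟨⌊x * ((n : ℝ) + 1)⌋₊, floor_mul_lt hx' n⟩) p hsum h0 hT
      (fun l k => tendsto_extend_matrix hx hcont l k)
    have h2 : ∑' k, ‖polyConv p (fun k => coeff a k x) k‖ ^ 2 ≤ s ^ 2 :=
      tsum_norm_sq_le_of_norm_trig_le (summable_norm_polyConv p hc) fun t => by
        rw [trig_polyConv p hc]; exact hxs t
    have h3 := (h1.sub_const (s ^ 2)).max (tendsto_const_nhds (x := (0 : ℝ)))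
    rw [max_eq_right (by linarith)] at h3
    refine h3.congr fun n => ?_
    rw [hg]
    dsimp only
    rw [dif_pos (floor_mul_lt hx' n)]
  filter_upwards [(tendsto_mean_zero hgC hlim).eventually (ge_mem_nhds hε)] with n hn
  have hn1 : (0 : ℝ) < (n : ℝ) + 1 := by positivity
  rw [inv_mul_le_iff₀ hn1, Finset.sum_range] at hn
  calc ∑ i, F n i ≤ ∑ i : Fin (n + 1), (s ^ 2 + g n i) := by
        refine Finset.sum_le_sum fun i _ => ?_
        rw [hg]
        dsimp only
        rw [dif_pos i.2]
        linarith [le_max_left (F n i - s ^ 2) 0]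
    _ ≤ (s ^ 2 + ε) * ((n : ℝ) + 1) := by
        rw [Finset.sum_add_distrib]
        simp only [Finset.sum_const, Finset.card_univ, Fintype.card_fin, nsmul_eq_mul]
        push_cast
        linarith

end KMS

/-! ### Range of the Fourier series, and counting eigenvalues. -/

namespace KMS

variable {a : ℝ → ℝ → ℂ}

/-- The essential range of the sum `∑ â_k(x) e^{ikt}` of the Fourier series of `a`. -/
def seriesRange (a : ℝ → ℝ → ℂ) : Set ℂ :=
  {z | ∀ r : ℝ, 0 < r → ¬ ∀ᵐ x ∂volume.restrict (Ioo (0 : ℝ) 1), ∀ t,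
    r ≤ ‖trig (fun k => coeff a k x) t - z‖}

theorem notMem_seriesRange {z : ℂ} : z ∉ seriesRange a ↔
    ∃ r : ℝ, 0 < r ∧ ∀ᵐ x ∂volume.restrict (Ioo (0 : ℝ) 1), ∀ t,
      r ≤ ‖trig (fun k => coeff a k x) t - z‖ := by
  simp [seriesRange]

theorem isClosed_seriesRange : IsClosed (seriesRange a) := by
  rw [← isOpen_compl_iff, Metric.isOpen_iff]
  intro z hz
  obtain ⟨r, hr, h⟩ := notMem_seriesRange.1 hz
  refine ⟨r / 2, half_pos hr, fun w hw => notMem_seriesRange.2 ⟨r / 2, half_pos hr, ?_⟩⟩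
  rw [Metric.mem_ball, dist_eq_norm] at hw
  filter_upwards [h] with x hx t
  have h1 := hx t
  have h2 := norm_add_le (trig (fun k => coeff a k x) t - w) (w - z)
  rw [sub_add_sub_cancel] at h2
  linarith

theorem seriesRange_subset_closedBall (hdecay : decayNorm a < ⊤) :
    seriesRange a ⊆ Metric.closedBall 0 (∑' k, supCoeff a k) := by
  intro z hz
  by_contra hzn
  rw [mem_closedBall_zero_iff, not_le] at hzn
  refine notMem_seriesRange.2 ⟨‖z‖ - ∑' k, supCoeff a k, sub_pos.2 hzn, ?_⟩ hz
  filter_upwards [ae_restrict_mem measurableSet_Ioo] with x hx t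
  have h1 := norm_trig_coeff_le hdecay (Ioo_subset_Icc_self hx) t
  have h2 := norm_sub_norm_le z (trig (fun k => coeff a k x) t)
  rw [norm_sub_rev] at h2
  linarith

/-- By the Lindelöf property, countably many balls, each avoided for a.e. x, cover the complement of
the range. -/
theorem ae_trig_mem_seriesRange :
    ∀ᵐ x ∂volume.restrict (Ioo (0 : ℝ) 1), ∀ t, trig (fun k => coeff a k x) t ∈ seriesRange a := by
  have h : ∀ z : ℂ, ∃ r : ℝ, 0 < r ∧ (z ∉ seriesRange a →
      ∀ᵐ x ∂volume.restrict (Ioo (0 : ℝ) 1), ∀ t, r ≤ ‖trig (fun k => coeff a k x) t - z‖) := by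
    intro z
    by_cases hz : z ∈ seriesRange a
    · exact ⟨1, one_pos, fun h => absurd hz h⟩
    · obtain ⟨r, hr, h⟩ := notMem_seriesRange.1 hz
      exact ⟨r, hr, fun _ => h⟩
  choose r hr hrz using h
  obtain ⟨s, hs, hsc, hcover⟩ := TopologicalSpace.countable_cover_nhdsWithin
    (f := fun z => Metric.ball z (r z)) (s := (seriesRange a)ᶜ)
    fun z _ => mem_nhdsWithin_of_mem_nhds (Metric.ball_mem_nhds z (hr z))
  have hall := (ae_ball_iff hsc).2 fun z hz => hrz z (hs hz)
  filter_upwards [hall] with x hx t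
  by_contra hmem
  obtain ⟨z, hz, hzt⟩ := mem_iUnion₂.1 (hcover hmem)
  rw [Metric.mem_ball, dist_eq_norm] at hzt
  exact absurd (hx z hz t) (not_le.2 hzt)

/-- The series is continuous on the circle, so the inequality fails on an open set; being null, that
set is empty. -/
theorem forall_le_norm_trig_sub_of_ae {c : ℤ → ℂ} (hc : Summable fun k => ‖c k‖) {r : ℝ} {z : ℂ}
    (h : ∀ᵐ t ∂volume.restrict (Icc (0 : ℝ) (2 * Real.pi)), r ≤ ‖trig c t - z‖) (t : ℝ) :
    r ≤ ‖trig c t - z‖ := by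
  set U : Set (AddCircle (2 * Real.pi)) := {θ | ‖circleSeries c θ - z‖ < r} with hU
  have hUo : IsOpen U := isOpen_lt (by fun_prop) continuous_const
  rw [← restrict_Ioc_eq_restrict_Icc] at h
  have hmp := AddCircle.measurePreserving_mk (2 * Real.pi) 0
  rw [zero_add] at hmp
  have hU0 : volume U = 0 := by
    rw [← hmp.measure_preimage hUo.measurableSet.nullMeasurableSet]
    refine measure_mono_null (fun s hs => ?_) (ae_iff.1 h)
    have hs' : ‖circleSeries c (s : AddCircle (2 * Real.pi)) - z‖ < r := hs
    rw [circleSeries_coe hc] at hs'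
    exact not_le.2 hs'
  by_contra ht
  have htU : (t : AddCircle (2 * Real.pi)) ∈ U := by
    rw [hU, mem_ofPred_eq, circleSeries_coe hc]
    exact not_le.1 ht
  rw [hUo.eq_empty_of_measure_zero hU0] at htU
  exact htU

/-- A null set in the plane has null sections for a.e. x. On such a section the lower bound for
|a(x,·) − z| holds a.e., passes to the Fourier series, and then holds for all t. -/
theorem seriesRange_subset_essRange
    (ha_t : ∀ x ∈ Icc (0 : ℝ) 1,
      MemLp (fun t => a x t) ⊤ (volume.restrict (Icc (0 : ℝ) (2 * Real.pi))))
    (hdecay : decayNorm a < ⊤) : seriesRange a ⊆ essRange a := by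
  intro z hz
  by_contra hzn
  simp only [essRange, mem_ofPred_eq, not_forall, not_lt, nonpos_iff_eq_zero] at hzn
  obtain ⟨r, hr, h⟩ := hzn
  refine notMem_seriesRange.2 ⟨r, hr, ?_⟩ hz
  have hae : ∀ᵐ p : ℝ × ℝ ∂(volume : Measure ℝ).prod volume,
      ¬ (p ∈ Icc (0 : ℝ) 1 ×ˢ Icc (0 : ℝ) (2 * Real.pi) ∧ a p.1 p.2 ∈ Metric.ball z r) := by
    rw [← Measure.volume_eq_prod, ae_iff]
    simpa only [not_not] using h
  rw [ae_restrict_iff' measurableSet_Ioo]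
  filter_upwards [Measure.ae_ae_of_ae_prod hae] with x hx hx01
  have hxI := Ioo_subset_Icc_self hx01
  have hc := summable_norm_coeff hdecay hxI
  refine forall_le_norm_trig_sub_of_ae hc ?_
  filter_upwards [ae_eq_trig (ha_t x hxI) hc fun k => rfl, ae_restrict_of_ae hx,
    ae_restrict_mem measurableSet_Icc] with t h1 h2 h3
  rw [← h1, ← dist_eq_norm]
  by_contra hlt
  exact h2 ⟨⟨hxI, h3⟩, not_le.1 hlt⟩

/-- Gershgorin's theorem puts every spectrum in one disc independent of n. -/
theorem norm_le_of_mem_roots (hdecay : decayNorm a < ⊤) (n : ℕ) {z : ℂ}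
    (hz : z ∈ (matrix a n).charpoly.roots) : ‖z‖ ≤ ∑' k, supCoeff a k := by
  have hroot := Polynomial.isRoot_of_mem_roots hz
  rw [← Matrix.charpoly_toLin', ← Module.End.hasEigenvalue_iff_isRoot_charpoly] at hroot
  obtain ⟨i, hi⟩ := eigenvalue_mem_ball hroot
  rw [Metric.mem_closedBall, dist_eq_norm] at hi
  have h1 : ‖z‖ ≤ ∑ j, ‖matrix a n i j‖ := by
    rw [← Finset.add_sum_erase _ _ (Finset.mem_univ i)]
    have := norm_add_le (matrix a n i i) (z - matrix a n i i)
    rw [add_sub_cancel] at this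
    linarith
  have h2 : ∑ j, ‖matrix a n i j‖ = ∑' l, ‖extend (matrix a n) ((i : ℕ) : ℤ) l‖ := by
    rw [tsum_int_eq_sum_fin (N := n + 1) fun l hl => by rw [extend_of_right hl, norm_zero]]
    simp_rw [extend_natCast]
  have hs : Summable fun l : ℤ => supCoeff a (l - ((i : ℕ) : ℤ)) :=
    (summable_supCoeff hdecay).comp_injective (sub_left_injective (b := ((i : ℕ) : ℤ)))
  have hle : ∀ l : ℤ, ‖extend (matrix a n) ((i : ℕ) : ℤ) l‖ ≤ supCoeff a (l - ((i : ℕ) : ℤ)) :=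
    norm_extend_matrix_le hdecay n ((i : ℕ) : ℤ)
  have h3 : ∑' l : ℤ, supCoeff a (l - ((i : ℕ) : ℤ)) = ∑' k, supCoeff a k :=
    (Equiv.subRight ((i : ℕ) : ℤ)).tsum_eq (supCoeff a)
  rw [h2] at h1
  rw [← h3]
  exact h1.trans ((hs.of_nonneg_of_le (fun _ => norm_nonneg _) hle).tsum_le_tsum hle hs)

open Classical in
/-- Chebyshev's inequality for the eigenvalues of a matrix. -/
theorem countP_roots_mul_le {n : ℕ} (M : Matrix (Fin n) (Fin n) ℂ) (p : Polynomial ℂ) {U : Set ℂ}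
    {δ : ℝ} (hδ : 0 ≤ δ) (hU : ∀ z ∈ U, δ ≤ ‖p.eval z‖) :
    (M.charpoly.roots.countP (fun z => z ∈ U) : ℝ) * δ ^ 2 ≤
      ∑ i, ∑ j, ‖Polynomial.aeval M p i j‖ ^ 2 := by
  refine le_trans ?_ (sum_norm_sq_eval_roots_le M p)
  induction M.charpoly.roots using Multiset.induction_on with
  | empty => simp
  | cons z s ih =>
    rw [Multiset.map_cons, Multiset.sum_cons]
    by_cases hz : z ∈ U
    · rw [Multiset.countP_cons_of_pos _ hz]
      have : δ ^ 2 ≤ ‖p.eval z‖ ^ 2 := by gcongr; exact hU z hz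
      push_cast
      linarith
    · rw [Multiset.countP_cons_of_neg _ hz]
      have : 0 ≤ ‖p.eval z‖ ^ 2 := by positivity
      linarith

/-- Near a point outside the extended range there are only `o(n)` eigenvalues. -/
theorem exists_ball_eigCount_isLittleO
    (ha_x : ∀ t ∈ Icc (0 : ℝ) (2 * Real.pi), RiemannIntegrable (fun x => a x t))
    (ha_t : ∀ x ∈ Icc (0 : ℝ) 1,
      MemLp (fun t => a x t) ⊤ (volume.restrict (Icc (0 : ℝ) (2 * Real.pi))))
    (hdecay : decayNorm a < ⊤) {z₀ : ℂ} (hz₀ : z₀ ∉ extRange a) :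
    ∃ ρ : ℝ, 0 < ρ ∧ (fun n : ℕ => (eigCount a (Metric.ball z₀ ρ) n : ℝ)) =o[atTop]
      (fun n : ℕ => (n : ℝ) + 1) := by
  have hK : IsCompact (seriesRange a) := Metric.isCompact_of_isClosed_isBounded
    isClosed_seriesRange (Metric.isBounded_closedBall.subset (seriesRange_subset_closedBall hdecay))
  have hsub := seriesRange_subset_essRange ha_t hdecay
  -- Shrinking the essential range to the series range only enlarges the complementary component of
  -- z₀, so the component stays unbounded.
  have hunb : ¬ Bornology.IsBounded (connectedComponentIn (seriesRange a)ᶜ z₀) := fun hb =>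
    hz₀ <| by
      by_cases hz : z₀ ∈ essRange a
      · exact Or.inl hz
      · exact Or.inr ⟨hz, hb.subset (connectedComponentIn_mono z₀ (compl_subset_compl.2 hsub))⟩
  obtain ⟨p, hp1, hpK⟩ := exists_polynomial_small_on hK hunb (by norm_num : (0 : ℝ) < 1 / 4)
  obtain ⟨ρ, hρ, hball⟩ : ∃ ρ > 0, ∀ z ∈ Metric.ball z₀ ρ, 1 / 2 ≤ ‖p.eval z‖ := by
    have hcont : Tendsto (fun z => ‖p.eval z‖) (𝓝 z₀) (𝓝 1) := by
      have := (p.continuous.norm).tendsto z₀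
      rwa [hp1, norm_one] at this
    exact Metric.eventually_nhds_iff_ball.1
      (hcont.eventually (le_mem_nhds (by norm_num : (1 / 2 : ℝ) < 1)))
  refine ⟨ρ, hρ, isLittleO_iff.2 fun ε hε => ?_⟩
  -- With q = p^m, |q|² is at least 4^{-m} on the ball and at most 16^{-m} on the range. Allowing
  -- another 16^{-m} for the error gives count · 4^{-m} ≤ 2 · 16^{-m} (n + 1), a fraction of at most
  -- 2 · 4^{-m} < ε.
  obtain ⟨m, hm⟩ := exists_pow_lt_of_lt_one (half_pos hε) (by norm_num : (1 / 4 : ℝ) < 1)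
  have hs : ∀ᵐ x ∂volume.restrict (Ioo (0 : ℝ) 1), ∀ t,
      ‖(p ^ m).eval (trig (fun k => coeff a k x) t)‖ ≤ (1 / 4) ^ m := by
    filter_upwards [ae_trig_mem_seriesRange (a := a)] with x hx t
    rw [Polynomial.eval_pow, norm_pow]
    gcongr
    exact hpK _ (hx t)
  have hpos : (0 : ℝ) < ((1 / 4) ^ m) ^ 2 := by positivity
  filter_upwards [eventually_sum_norm_sq_aeval_le ha_x ha_t hdecay (p ^ m) hs hpos] with n hn
  have hcount := countP_roots_mul_le (matrix a n) (p ^ m) (U := Metric.ball z₀ ρ)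
    (δ := (1 / 2) ^ m) (by positivity) fun z hz => by
      rw [Polynomial.eval_pow, norm_pow]
      have := hball z hz
      gcongr
  have h := hcount.trans hn
  have h4 : ((1 / 2 : ℝ) ^ m) ^ 2 = (1 / 4) ^ m := by
    rw [← pow_mul, mul_comm, pow_mul]; norm_num
  rw [h4, sq] at h
  have hq : (0 : ℝ) < (1 / 4) ^ m := by positivity
  have hn1 : (0 : ℝ) < (n : ℝ) + 1 := by positivity
  rw [Real.norm_of_nonneg (Nat.cast_nonneg _), Real.norm_of_nonneg hn1.le]
  have h5 : (eigCount a (Metric.ball z₀ ρ) n : ℝ) ≤ 2 * (1 / 4) ^ m * ((n : ℝ) + 1) := by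
    refine le_of_mul_le_mul_right ?_ hq
    calc (eigCount a (Metric.ball z₀ ρ) n : ℝ) * (1 / 4) ^ m ≤ _ := h
      _ = 2 * (1 / 4) ^ m * ((n : ℝ) + 1) * (1 / 4) ^ m := by ring
  refine h5.trans ?_
  gcongr
  linarith

open Classical in
theorem countP_le_sum_countP {s : Multiset ℂ} {W : Set ℂ} {t : Finset ℂ} {U : ℂ → Set ℂ}
    (h : ∀ z ∈ s, z ∈ W → ∃ w ∈ t, z ∈ U w) :
    s.countP (fun z => z ∈ W) ≤ ∑ w ∈ t, s.countP (fun z => z ∈ U w) := by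
  induction s using Multiset.induction_on with
  | empty => simp
  | cons z s ih =>
    have ih' := ih fun y hy => h y (Multiset.mem_cons_of_mem hy)
    simp only [Multiset.countP_cons, Finset.sum_add_distrib]
    refine add_le_add ih' ?_
    split_ifs with hz
    · obtain ⟨w, hw, hzw⟩ := h z (Multiset.mem_cons_self z s) hz
      exact le_trans (by simp [hzw]) (Finset.single_le_sum
        (f := fun w => if z ∈ U w then 1 else 0) (fun _ _ => Nat.zero_le _) hw)
    · exact Nat.zero_le _

/-- Only `o(n)` eigenvalues lie outside a neighbourhood of the extended range. -/
theorem eigCount_compl_isLittleO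
    (ha_x : ∀ t ∈ Icc (0 : ℝ) (2 * Real.pi), RiemannIntegrable (fun x => a x t))
    (ha_t : ∀ x ∈ Icc (0 : ℝ) 1,
      MemLp (fun t => a x t) ⊤ (volume.restrict (Icc (0 : ℝ) (2 * Real.pi))))
    (hdecay : decayNorm a < ⊤) {V : Set ℂ} (hV : IsOpen V) (haV : extRange a ⊆ V) :
    (fun n : ℕ => (eigCount a Vᶜ n : ℝ)) =o[atTop] (fun n : ℕ => (n : ℝ) + 1) := by
  -- Eigenvalues outside V lie in this compact set, which finitely many of the sparse balls cover.
  set C := Metric.closedBall (0 : ℂ) (∑' k, supCoeff a k) ∩ Vᶜ with hC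
  have hCc : IsCompact C := (isCompact_closedBall _ _).inter_right hV.isClosed_compl
  have hloc : ∀ z : ℂ, ∃ ρ : ℝ, 0 < ρ ∧ (z ∉ V →
      (fun n : ℕ => (eigCount a (Metric.ball z ρ) n : ℝ)) =o[atTop]
        (fun n : ℕ => (n : ℝ) + 1)) := by
    intro z
    by_cases hz : z ∈ V
    · exact ⟨1, one_pos, fun h => absurd hz h⟩
    · obtain ⟨ρ, hρ, h⟩ := exists_ball_eigCount_isLittleO ha_x ha_t hdecay fun h => hz (haV h)
      exact ⟨ρ, hρ, fun _ => h⟩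
  choose ρ hρ hlo using hloc
  obtain ⟨t, htC, hcover⟩ := hCc.elim_nhds_subcover (fun z => Metric.ball z (ρ z))
    fun z _ => Metric.ball_mem_nhds z (hρ z)
  have hsum : (fun n : ℕ => ∑ w ∈ t, (eigCount a (Metric.ball w (ρ w)) n : ℝ)) =o[atTop]
      (fun n : ℕ => (n : ℝ) + 1) := IsLittleO.fun_sum fun w hw => hlo w (htC w hw).2
  refine IsBigO.trans_isLittleO (IsBigO.of_bound 1 (Eventually.of_forall fun n => ?_)) hsum
  rw [one_mul, Real.norm_of_nonneg (Nat.cast_nonneg _),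
    Real.norm_of_nonneg (Finset.sum_nonneg fun _ _ => Nat.cast_nonneg _)]
  have := countP_le_sum_countP (s := (matrix a n).charpoly.roots) (W := Vᶜ) (t := t)
    (U := fun w => Metric.ball w (ρ w)) fun z hz hzV => by
      have hzC : z ∈ C := ⟨mem_closedBall_zero_iff.2 (norm_le_of_mem_roots hdecay n hz), hzV⟩
      simpa using hcover hzC
  unfold eigCount
  exact_mod_cast this

theorem eigCount_add_eigCount_compl (V : Set ℂ) (n : ℕ) :
    eigCount a V n + eigCount a Vᶜ n = n + 1 := by
  classical
  have hcard : (matrix a n).charpoly.roots.card = n + 1 := by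
    rw [Polynomial.splits_iff_card_roots.1 (IsAlgClosed.splits _),
      Matrix.charpoly_natDegree_eq_dim, Fintype.card_fin]
  rw [← hcard, Multiset.card_eq_countP_add_countP (fun z => z ∈ V)]
  unfold eigCount
  congr!

end KMS

theorem mainTheorem3 (a : ℝ → ℝ → ℂ)
    (ha_x : ∀ t ∈ Icc (0 : ℝ) (2 * Real.pi), KMS.RiemannIntegrable (fun x => a x t))
    (ha_t : ∀ x ∈ Icc (0 : ℝ) 1,
      MemLp (fun t => a x t) ⊤ (volume.restrict (Icc (0 : ℝ) (2 * Real.pi))))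
    (hdecay : KMS.decayNorm a < ⊤)
    (V : Set ℂ) (hV : IsOpen V) (haV : KMS.extRange a ⊆ V) :
    Tendsto (fun n : ℕ => (KMS.eigCount a V n : ℝ) / ((n : ℝ) + 1)) atTop (𝓝 1) ∧
      (fun n : ℕ => (KMS.eigCount a Vᶜ n : ℝ)) =o[atTop] (fun n : ℕ => (n : ℝ)) := by
  have h := KMS.eigCount_compl_isLittleO ha_x ha_t hdecay hV haV
  constructor
  · have h0 := h.tendsto_div_nhds_zero
    have h1 := (tendsto_const_nhds (x := (1 : ℝ))).sub h0
    rw [sub_zero] at h1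
    refine h1.congr fun n => ?_
    have hn1 : (n : ℝ) + 1 ≠ 0 := by positivity
    have hadd : (KMS.eigCount a V n : ℝ) + KMS.eigCount a Vᶜ n = n + 1 := by
      exact_mod_cast KMS.eigCount_add_eigCount_compl V n
    rw [eq_div_iff hn1, sub_mul, div_mul_cancel₀ _ hn1]
    linarith
  · refine h.trans_isBigO (IsBigO.of_bound 2 ?_)
    filter_upwards [eventually_ge_atTop 1] with n hn
    have hn' : (1 : ℝ) ≤ n := by exact_mod_cast hn
    rw [Real.norm_of_nonneg (by positivity), Real.norm_of_nonneg (by positivity)]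
    linarith
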